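/- Let $\zeta_n=(1,2,\dots,n)$ be the circular permutation of $\{1,\dots,n\}$, and let $z(\alpha)$ denote the number of cycles (fixed points included) of a permutation $\alpha$ of $\{1,\dots,n\}$. The genus $g(\alpha)$ of $\alpha$ is defined by $$n+1-2g(\alpha)=z(\alpha)+z(\alpha^{-1}\zeta_n),$$ where permutations are composed from right to left. To a partition $P$ of $\{1,\dots,n\}$ one associates the permutation $\alpha_P$ whose cycles are the blocks of $P$, each written with its elements in increasing order; the genus of $P$ is $g(\alpha_P)$. A cycle of a permutation of $\{1,\dots,n\}$ is trivial if it has the form $(i,i+1,\dots,i+p)$ with $0\le p<n$, where sums are taken modulo $n$; a permutation is reduced if it has no trivial cycle, and a partition $P$ is reduced if $\alpha_P$ is reduced. **Theorem.** For all integers $n,k\ge 0$, the number $r_0(n,k)$ of reduced partitions of genus $1$ of the set $\{1,\dots,n\}$ having $k$ blocks is $$r_0(n,k)=\binom{n}{2k}\binom{k+1}{3}.$$ Moreover, the ordinary generating function of these partitions is, as a formal power series in $x$ and $y$, $$R_0(x,y)=\sum_{n,k\ge 0} r_0(n,k)\,x^n y^k=\frac{y^2x^4(1-x)^3}{\left((1-x)^2-yx^2\right)^4}.$$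 -/

import Mathlib

open Finset
open MvPowerSeries (X)

namespace GenusPartition

/-! The points `1, …, n` are represented by the elements `0, …, n - 1` of `Fin n`, in the same
order, so that the circular permutation `ζ_n = (1, 2, …, n)` is `finRotate n`. -/

/-- The number `z(α)` of cycles of a permutation, fixed points included. -/
noncomputable def numCycles {n : ℕ} (α : Equiv.Perm (Fin n)) : ℕ :=
  Nat.card (Quotient (Equiv.Perm.SameCycle.setoid α))

/-- `g` is the genus of the permutation `α`:
`n + 1 - 2 g = z(α) + z(α⁻¹ ζ_n)`. There is at most one such `g`. -/
def HasGenus {n : ℕ} (α : Equiv.Perm (Fin n)) (g : ℕ) : Prop :=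
  (n : ℤ) + 1 - 2 * (g : ℤ) = (numCycles α : ℤ) + (numCycles (α⁻¹ * finRotate n) : ℤ)

/-- The permutation `α` has a trivial cycle, i.e. a cycle `(i, i + 1, …, i + p)` consisting of
consecutive points on the circle. The bound `p < n` says that these points are distinct. -/
def HasTrivialCycle {n : ℕ} (α : Equiv.Perm (Fin n)) : Prop :=
  ∃ (i : Fin n) (p : ℕ), p < n ∧
    (∀ t < p, α ((finRotate n ^ t) i) = (finRotate n ^ (t + 1)) i) ∧
    α ((finRotate n ^ p) i) = i

/-- A permutation is reduced if it has no trivial cycle. -/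
def IsReduced {n : ℕ} (α : Equiv.Perm (Fin n)) : Prop := ¬ HasTrivialCycle α

/-- The successor of `i` in its block written as a cycle in increasing order: the next larger
element of the block, or the smallest element of the block if `i` is its largest element. -/
def blockNext {n : ℕ} (P : Finpartition (univ : Finset (Fin n))) (i : Fin n) : Fin n :=
  if h : ((P.part i).filter (fun j => i < j)).Nonempty then
    ((P.part i).filter (fun j => i < j)).min' h
  else (P.part i).min' ⟨i, P.mem_part (mem_univ i)⟩

theorem blockNext_mem {n : ℕ} (P : Finpartition (univ : Finset (Fin n))) (i : Fin n) :
    blockNext P i ∈ P.part i := by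
  unfold blockNext
  split_ifs with h
  · exact (mem_filter.1 (min'_mem _ h)).1
  · exact min'_mem _ _

theorem blockNext_injective {n : ℕ} (P : Finpartition (univ : Finset (Fin n))) :
    Function.Injective (blockNext P) := by
  have key : ∀ x y : Fin n, x < y → blockNext P x ≠ blockNext P y := by
    intro x y hxy he
    have hx := blockNext_mem P x
    have hy := blockNext_mem P y
    have hpart : P.part x = P.part y := by
      rw [he] at hx
      exact P.eq_of_mem_parts (P.part_mem.2 (mem_univ x)) (P.part_mem.2 (mem_univ y)) hx hy
    have hyx : y ∈ P.part x := by
      rw [hpart]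
      exact P.mem_part (mem_univ y)
    have hmem : y ∈ (P.part x).filter (fun j => x < j) := mem_filter.2 ⟨hyx, hxy⟩
    have h1 : blockNext P x ≤ y := by
      unfold blockNext
      rw [dif_pos ⟨y, hmem⟩]
      exact min'_le _ _ hmem
    have h2 : x < blockNext P x := by
      unfold blockNext
      rw [dif_pos ⟨y, hmem⟩]
      exact (mem_filter.1 (min'_mem _ ⟨y, hmem⟩)).2
    rw [he] at h1 h2
    unfold blockNext at h1 h2
    split_ifs at h1 h2 with h
    · exact absurd (mem_filter.1 (min'_mem _ h)).2 (not_lt.2 h1)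
    · exact absurd (min'_le _ x (hpart ▸ P.mem_part (mem_univ x))) (not_le.2 h2)
  intro x y he
  rcases lt_trichotomy x y with h | h | h
  · exact absurd he (key x y h)
  · exact h
  · exact absurd he.symm (key y x h)

/-- The permutation `α_P` associated to the partition `P`: its cycles are the blocks of `P`,
written with their elements in increasing order. -/
noncomputable def partitionPerm {n : ℕ} (P : Finpartition (univ : Finset (Fin n))) :
    Equiv.Perm (Fin n) :=
  Equiv.ofBijective (blockNext P) (Finite.injective_iff_bijective.1 (blockNext_injective P))

/-- The number `r₀(n, k)` of reduced partitions of genus one of an `n`-element set with `k`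
blocks. -/
noncomputable def r₀ (n k : ℕ) : ℕ :=
  Nat.card {P : Finpartition (univ : Finset (Fin n)) //
    P.parts.card = k ∧ HasGenus (partitionPerm P) 1 ∧ IsReduced (partitionPerm P)}

/-- The ordinary generating function `R₀(x, y) = ∑ r₀(n, k) x ^ n y ^ k`, a formal power series in
the variables `x` (index `0`) and `y` (index `1`). -/
noncomputable def R₀ : MvPowerSeries (Fin 2) ℚ := fun m => (r₀ (m 0) (m 1) : ℚ)

end GenusPartition

/-! Write `α = ζ ψ`; then `α⁻¹ ζ = ψ⁻¹`, and `ψ` fixes exactly the points with `α x = ζ x`. Deleting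
these points leaves a fixed-point-free `ψ'` on `m` points, and `ζ ψ'` is the first return map of
`α`. The genus is unchanged, and `α` is reduced iff `ζ ψ'` has no fixed point. With `k` cycles in
`α`, genus one means `z(ψ') = m - 1 - k`.

A permutation comes from a partition iff each cycle has a single weak anti-excedance. Counting these
gives `k ≥ z(ψ') + 1 = m - k`, while the absence of fixed points gives `2 k ≤ m`. Hence `m = 2 k`
and `τ = ζ ψ'` is a pairing without neighbouring pairs, of genus one. Choosing the `2 k` points
yields the factor `n.choose (2 * k)` (`r₀_eq_choose_mul`).

To count these pairings, let `φ = τ ζ = ψ'⁻¹`, which has `k - 1` cycles on `2 k` points, all of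
length at least two. So between 3 and 6 points (the breaks) lie on longer cycles (`card_breaks`).
Cutting the circle after the breaks gives pieces that `τ` maps onto one another by reversal
(`exists_matching_of_pieces`). Only 4 or 6 pieces are possible, with opposite pieces matched, and
all such pairings are parametrised by `a < b < c ≤ k`; there are `(k + 1).choose 3` of them.

The generating function follows by taking successive differences in `k` (`mul_chooseSeries`). -/

namespace GenusPartition

open Equiv (Perm)

/-! ### Counting cycles, and weak anti-excedances -/

section CycleCount

variable {n : ℕ}

theorem numCycles_eq_card_of_surjective {β : Type*} (α : Perm (Fin n)) (f : Fin n → β)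
    (hf : Function.Surjective f) (h : ∀ x y, f x = f y ↔ α.SameCycle x y) :
    numCycles α = Nat.card β := by
  refine Nat.card_congr (Equiv.ofBijective
    (Quotient.lift (s := Perm.SameCycle.setoid α) f fun x y hxy => (h x y).2 hxy) ⟨?_, ?_⟩)
  · intro a b
    induction a using Quotient.inductionOn
    induction b using Quotient.inductionOn
    intro hab
    exact Quotient.sound ((h _ _).1 hab)
  · intro b
    obtain ⟨x, rfl⟩ := hf b
    exact ⟨Quotient.mk _ x, rfl⟩

theorem sameCycle_iff_exists_pow {β : Type*} [Finite β] (α : Perm β) (x y : β) :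
    α.SameCycle x y ↔ ∃ i : ℕ, (α ^ i) x = y :=
  ⟨fun h => h.exists_nat_pow_eq, fun ⟨i, hi⟩ => ⟨i, by simpa using hi⟩⟩

theorem numCycles_inv (α : Perm (Fin n)) : numCycles α⁻¹ = numCycles α :=
  numCycles_eq_card_of_surjective α⁻¹
    (fun x => (Quotient.mk (Perm.SameCycle.setoid α) x)) Quotient.mk_surjective
    fun x y => by
      rw [Perm.sameCycle_inv]
      exact Quotient.eq (r := Perm.SameCycle.setoid α)

open Classical in
/-- The support of the cycle through `x`, also when `x` is a fixed point. -/
noncomputable def cycleSet (α : Perm (Fin n)) (x : Fin n) : Finset (Fin n) :=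
  univ.filter fun y => α.SameCycle x y

theorem mem_cycleSet {α : Perm (Fin n)} {x y : Fin n} : y ∈ cycleSet α x ↔ α.SameCycle x y := by
  simp [cycleSet]

theorem self_mem_cycleSet (α : Perm (Fin n)) (x : Fin n) : x ∈ cycleSet α x :=
  mem_cycleSet.2 (Perm.SameCycle.refl _ _)

theorem apply_mem_cycleSet (α : Perm (Fin n)) (x : Fin n) : α x ∈ cycleSet α x :=
  mem_cycleSet.2 ⟨1, by simp⟩

/-- Each cycle contributes 1 in total. All later bounds on numbers of cycles are bounds on the terms
of this sum. -/
theorem sum_inv_card_cycleSet (α : Perm (Fin n)) :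
    ∑ x, ((#(cycleSet α x) : ℚ))⁻¹ = numCycles α := by
  classical
  let q : Fin n → Quotient (Perm.SameCycle.setoid α) := Quotient.mk _
  have : Fintype (Quotient (Perm.SameCycle.setoid α)) := Fintype.ofFinite _
  rw [← Finset.sum_fiberwise (s := univ) (g := q), numCycles, Nat.card_eq_fintype_card,
    Fintype.card_eq_sum_ones, Nat.cast_sum]
  refine Finset.sum_congr rfl fun c _ => ?_
  obtain ⟨x, rfl⟩ := Quotient.mk_surjective c
  have hfil : (univ.filter fun y => q y = ⟦x⟧) = cycleSet α x := by
    ext y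
    simp only [mem_filter, mem_univ, true_and, mem_cycleSet, q]
    rw [Quotient.eq (r := Perm.SameCycle.setoid α)]
    exact Perm.sameCycle_comm
  rw [hfil]
  have hc : ∀ y ∈ cycleSet α x, ((#(cycleSet α y) : ℚ))⁻¹ = ((#(cycleSet α x) : ℚ))⁻¹ := by
    intro y hy
    have : cycleSet α y = cycleSet α x := by
      ext z
      rw [mem_cycleSet] at *
      rw [mem_cycleSet]
      exact ⟨fun h => hy.trans h, fun h => hy.symm.trans h⟩
    rw [this]
  rw [Finset.sum_congr rfl hc, sum_const, nsmul_eq_mul]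
  have : (0 : ℚ) < #(cycleSet α x) := by
    exact_mod_cast Finset.card_pos.2 ⟨x, self_mem_cycleSet α x⟩
  rw [mul_inv_cancel₀ this.ne']
  simp

theorem card_cycleSet_le {α : Perm (Fin n)} {x : Fin n} {p : ℕ} (hp : 0 < p)
    (h : (α ^ p) x = x) : #(cycleSet α x) ≤ p := by
  classical
  have : cycleSet α x ⊆ (range p).image fun i => (α ^ i) x := by
    intro y hy
    obtain ⟨i, rfl⟩ := (sameCycle_iff_exists_pow _ _ _).1 (mem_cycleSet.1 hy)
    refine mem_image.2 ⟨i % p, mem_range.2 (Nat.mod_lt _ hp), ?_⟩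
    have hfix : ∀ j : ℕ, ((α ^ p) ^ j) x = x := by
      intro j
      induction j with
      | zero => simp
      | succ j ih => rw [pow_succ, Perm.mul_apply, h, ih]
    conv_rhs => rw [← Nat.mod_add_div i p, pow_add, pow_mul, Perm.mul_apply, hfix]
  calc _ ≤ _ := card_le_card this
    _ ≤ _ := card_image_le
    _ = p := card_range p

theorem two_le_card_cycleSet {α : Perm (Fin n)} {x : Fin n} (h : α x ≠ x) :
    2 ≤ #(cycleSet α x) := by
  classical
  have : ({x, α x} : Finset (Fin n)) ⊆ cycleSet α x := by
    intro y hy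
    simp only [mem_insert, mem_singleton] at hy
    rcases hy with rfl | rfl
    exacts [self_mem_cycleSet _ _, apply_mem_cycleSet _ _]
  calc 2 = _ := (card_pair h.symm).symm
    _ ≤ _ := card_le_card this

theorem three_le_card_cycleSet {α : Perm (Fin n)} {x : Fin n} (h : α x ≠ x)
    (h2 : α (α x) ≠ x) : 3 ≤ #(cycleSet α x) := by
  classical
  have : ({x, α x, α (α x)} : Finset (Fin n)) ⊆ cycleSet α x := by
    intro y hy
    simp only [mem_insert, mem_singleton] at hy
    rcases hy with rfl | rfl | rfl
    exacts [self_mem_cycleSet _ _, apply_mem_cycleSet _ _,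
      mem_cycleSet.2 ⟨2, by simp [zpow_ofNat, sq]⟩]
  calc 3 = _ := (card_eq_three.2 ⟨x, α x, α (α x), h.symm, h2.symm,
        fun e => h (α.injective e.symm), rfl⟩).symm
    _ ≤ _ := card_le_card this

theorem cycleSet_eq {α : Perm (Fin n)} {x y : Fin n} (h : y ∈ cycleSet α x) :
    cycleSet α y = cycleSet α x := by
  ext z
  rw [mem_cycleSet] at *
  rw [mem_cycleSet]
  exact ⟨fun h' => h.trans h', fun h' => h.symm.trans h'⟩

/-- The set of weak anti-excedances of a permutation. -/
def antiexc (α : Perm (Fin n)) : Finset (Fin n) := univ.filter fun i => α i ≤ i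

theorem mem_antiexc {α : Perm (Fin n)} {i : Fin n} : i ∈ antiexc α ↔ α i ≤ i := by
  simp [antiexc]

theorem max_cycleSet_mem_antiexc (α : Perm (Fin n)) (x : Fin n) :
    (cycleSet α x).max' ⟨x, self_mem_cycleSet α x⟩ ∈ antiexc α := by
  rw [mem_antiexc]
  have hm := max'_mem (cycleSet α x) ⟨x, self_mem_cycleSet α x⟩
  exact le_max' _ _ (mem_cycleSet.2 ((mem_cycleSet.1 hm).trans ⟨1, by simp⟩))

theorem mk_antiexc_surjective (α : Perm (Fin n)) :
    Function.Surjective fun i : antiexc α => Quotient.mk (Perm.SameCycle.setoid α) i.1 := by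
  intro c
  obtain ⟨x, rfl⟩ := Quotient.mk_surjective c
  refine ⟨⟨_, max_cycleSet_mem_antiexc α x⟩, Quotient.sound ?_⟩
  have hm := max'_mem (cycleSet α x) ⟨x, self_mem_cycleSet α x⟩
  exact (mem_cycleSet.1 hm).symm

theorem numCycles_le_card_antiexc (α : Perm (Fin n)) : numCycles α ≤ #(antiexc α) := by
  have := Nat.card_le_card_of_surjective _ (mk_antiexc_surjective α)
  simpa [numCycles] using this

theorem eq_of_mem_antiexc {α : Perm (Fin n)} (h : #(antiexc α) = numCycles α) {i j : Fin n}
    (hi : i ∈ antiexc α) (hj : j ∈ antiexc α) (hij : α.SameCycle i j) : i = j := by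
  have hb := (Nat.bijective_iff_surjective_and_card _).2
    ⟨mk_antiexc_surjective α, by simpa [numCycles] using h⟩
  have := @hb.1 ⟨i, hi⟩ ⟨j, hj⟩ (Quotient.sound hij)
  simpa using this

end CycleCount

/-! ### Permutations that come from partitions -/

section Partition

variable {n : ℕ} (P : Finpartition (univ : Finset (Fin n)))

theorem partitionPerm_apply (i : Fin n) : partitionPerm P i = blockNext P i := rfl

theorem mem_part_comm {i j : Fin n} : i ∈ P.part j ↔ P.part i = P.part j :=
  P.mem_part_iff_part_eq_part (mem_univ _) (mem_univ _)

theorem part_blockNext (i : Fin n) : P.part (blockNext P i) = P.part i :=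
  (mem_part_comm P).1 (blockNext_mem P i)

theorem lt_blockNext {i j : Fin n} (hj : j ∈ P.part i) (hij : i < j) :
    i < blockNext P i ∧ blockNext P i ≤ j := by
  have hmem : j ∈ (P.part i).filter (fun j => i < j) := mem_filter.2 ⟨hj, hij⟩
  unfold blockNext
  rw [dif_pos ⟨j, hmem⟩]
  exact ⟨(mem_filter.1 (min'_mem _ ⟨j, hmem⟩)).2, min'_le _ _ hmem⟩

theorem blockNext_le {i j : Fin n} (hmax : ∀ j ∈ P.part i, j ≤ i) (hj : j ∈ P.part i) :
    blockNext P i ≤ j := by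
  unfold blockNext
  rw [dif_neg]
  · exact min'_le _ _ hj
  · rintro ⟨j, hj⟩
    rw [mem_filter] at hj
    exact absurd hj.2 (not_lt.2 (hmax j hj.1))

theorem part_eq_of_sameCycle {i j : Fin n} (h : (partitionPerm P).SameCycle i j) :
    P.part i = P.part j := by
  obtain ⟨t, rfl⟩ := (sameCycle_iff_exists_pow _ _ _).1 h
  clear h
  induction t with
  | zero => simp
  | succ t ih => rw [pow_succ', Perm.mul_apply, partitionPerm_apply, part_blockNext, ih]

theorem sameCycle_of_mem_part {i j : Fin n} (hj : j ∈ P.part i) (hij : i ≤ j) :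
    (partitionPerm P).SameCycle i j := by
  induction i using WellFoundedGT.induction with
  | ind i ih =>
    rcases hij.eq_or_lt with rfl | hlt
    · exact Perm.SameCycle.refl _ _
    · obtain ⟨h1, h2⟩ := lt_blockNext P hj hlt
      have := ih (blockNext P i) h1 (by rwa [part_blockNext]) h2
      exact Perm.SameCycle.trans ⟨1, by simp [partitionPerm_apply]⟩ this

theorem sameCycle_partitionPerm_iff {i j : Fin n} :
    (partitionPerm P).SameCycle i j ↔ P.part i = P.part j := by
  refine ⟨part_eq_of_sameCycle P, fun h => ?_⟩
  rcases le_total i j with hij | hij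
  · exact sameCycle_of_mem_part P ((mem_part_comm P).2 h.symm) hij
  · exact (sameCycle_of_mem_part P ((mem_part_comm P).2 h) hij).symm

theorem numCycles_partitionPerm : numCycles (partitionPerm P) = #P.parts := by
  rw [numCycles_eq_card_of_surjective (β := P.parts) (partitionPerm P)
    (fun i => ⟨P.part i, P.part_mem.2 (mem_univ i)⟩)]
  · simp
  · rintro ⟨p, hp⟩
    obtain ⟨i, hi⟩ := P.nonempty_of_mem_parts hp
    exact ⟨i, Subtype.ext (P.part_eq_of_mem hp hi)⟩
  · intro x y
    rw [sameCycle_partitionPerm_iff, Subtype.mk.injEq]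

/-- In a block written increasingly, only the largest element fails to move up. -/
theorem card_antiexc_partitionPerm :
    #(antiexc (partitionPerm P)) = numCycles (partitionPerm P) := by
  refine le_antisymm ?_ (numCycles_le_card_antiexc _)
  have hinj : Function.Injective fun i : antiexc (partitionPerm P) =>
      Quotient.mk (Perm.SameCycle.setoid (partitionPerm P)) i.1 := by
    have key : ∀ i j : Fin n, i ∈ antiexc (partitionPerm P) → P.part i = P.part j → j ≤ i := by
      intro i j hi hij
      by_contra hlt
      have := (lt_blockNext P ((mem_part_comm P).2 hij.symm) (not_le.1 hlt)).1
      rw [mem_antiexc, partitionPerm_apply] at hi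
      exact absurd hi (not_le.2 this)
    rintro ⟨i, hi⟩ ⟨j, hj⟩ hij
    have hp := (sameCycle_partitionPerm_iff P).1 (Quotient.exact hij)
    exact Subtype.ext (le_antisymm (key j i hj hp.symm) (key i j hi hp))
  have := Nat.card_le_card_of_injective _ hinj
  simpa [numCycles] using this

theorem partitionPerm_injective :
    Function.Injective (partitionPerm (n := n)) := by
  intro P Q h
  have hpart : ∀ i, P.part i = Q.part i := by
    intro i
    ext j
    rw [mem_part_comm, mem_part_comm, ← sameCycle_partitionPerm_iff, h,
      sameCycle_partitionPerm_iff]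
  have key : ∀ P Q : Finpartition (univ : Finset (Fin n)), (∀ i, P.part i = Q.part i) →
      P.parts ⊆ Q.parts := by
    intro P Q h p hp
    obtain ⟨i, hi⟩ := P.nonempty_of_mem_parts hp
    rw [← P.part_eq_of_mem hp hi, h]
    exact Q.part_mem.2 (mem_univ i)
  exact Finpartition.ext ((key P Q hpart).antisymm (key Q P fun i => (hpart i).symm))

/-- Let `P` consist of the supports of the cycles. The next element in the block is the least value
that `α i` can take: if `α i ≤ i`, then `i` is the maximum of its cycle and the next element is the
minimum. A pointwise inequality between two permutations is an equality, since their values have the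
same sum. -/
theorem exists_partitionPerm_eq {α : Perm (Fin n)} (h : #(antiexc α) = numCycles α) :
    ∃ P, partitionPerm P = α := by
  classical
  let P : Finpartition (univ : Finset (Fin n)) := Finpartition.ofSetoid (Perm.SameCycle.setoid α)
  have hP : ∀ i j, j ∈ P.part i ↔ α.SameCycle i j := fun i j =>
    Finpartition.mem_part_ofSetoid_iff_rel
  have hle : ∀ i, partitionPerm P i ≤ α i := by
    intro i
    have hα : α i ∈ P.part i := (hP _ _).2 ⟨1, by simp⟩
    rw [partitionPerm_apply]
    by_cases hi : α i ≤ i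
    · refine blockNext_le P (fun j hj => ?_) hα
      have hm := max'_mem (cycleSet α i) ⟨i, self_mem_cycleSet α i⟩
      have := eq_of_mem_antiexc h (mem_antiexc.2 hi) (max_cycleSet_mem_antiexc α i)
        (mem_cycleSet.1 hm)
      rw [this]
      exact le_max' _ _ (mem_cycleSet.2 ((hP _ _).1 hj))
    · exact (lt_blockNext P hα (not_le.1 hi)).2
  refine ⟨P, Equiv.ext fun i => ?_⟩
  have hsum : ∑ i, (partitionPerm P i : ℕ) = ∑ i, (α i : ℕ) := by
    rw [Equiv.sum_comp (partitionPerm P) (fun i => (i : ℕ)), Equiv.sum_comp α (fun i => (i : ℕ))]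
  exact Fin.ext ((Finset.sum_eq_sum_iff_of_le fun i _ => Fin.le_def.1 (hle i)).1 hsum i
    (mem_univ i))

end Partition

/-! ### First return maps and rotations -/

section InducedPerm

/-- If `β` is the first return map of `α` to the image of `e`, then `e` respects and reflects
cycles. -/
theorem sameCycle_iff_of_firstReturn {A B : Type*} [Finite A] [Finite B] {α : Perm A} {β : Perm B}
    {e : B → A} (he : Function.Injective e)
    (h : ∀ b, ∃ r : ℕ, (α ^ (r + 1)) (e b) = e (β b) ∧
      ∀ s < r, (α ^ (s + 1)) (e b) ∉ Set.range e) (a b : B) :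
    α.SameCycle (e a) (e b) ↔ β.SameCycle a b := by
  constructor
  · intro hab
    obtain ⟨t, ht⟩ := (sameCycle_iff_exists_pow _ _ _).1 hab
    clear hab
    induction t using Nat.strong_induction_on generalizing a with
    | _ t ih =>
      rcases t with _ | t
      · have hab : a = b := he (by simpa using ht)
        rw [hab]
      · obtain ⟨r, hr, hs⟩ := h a
        have hrt : r ≤ t := by
          by_contra hlt
          exact hs t (not_le.1 hlt) ⟨b, ht.symm⟩
        have hsplit : t + 1 = (t - r) + (r + 1) := by omega
        rw [hsplit, pow_add, Perm.mul_apply, hr] at ht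
        exact Perm.SameCycle.trans ⟨1, by simp⟩ (ih (t - r) (by omega) (β a) ht)
  · intro hab
    obtain ⟨t, rfl⟩ := (sameCycle_iff_exists_pow _ _ _).1 hab
    clear hab
    induction t with
    | zero => exact Perm.SameCycle.refl _ _
    | succ t ih =>
      refine ih.trans ?_
      obtain ⟨r, hr, -⟩ := h ((β ^ t) a)
      rw [pow_succ', Perm.mul_apply, ← hr]
      exact ⟨(r + 1 : ℕ), by rw [zpow_natCast]⟩

end InducedPerm

section Rotation

variable {m n : ℕ}

theorem val_finRotate (i : Fin n) : (finRotate n i : ℕ) = (i + 1) % n := by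
  cases n with
  | zero => exact i.elim0
  | succ n =>
    rw [finRotate_apply, Fin.val_add]
    simp

theorem val_finRotate_pow (s : ℕ) (i : Fin n) : ((finRotate n ^ s) i : ℕ) = (i + s) % n := by
  induction s with
  | zero => simp [Nat.mod_eq_of_lt i.2]
  | succ s ih => rw [pow_succ', Perm.mul_apply, val_finRotate, ih, Nat.mod_add_mod, add_assoc]

/-- An order embedding preserves the circular order. The bound `r < n` is sharp when `m = 1`. -/
theorem finRotate_firstReturn (e : Fin m ↪o Fin n) (a : Fin m) :
    ∃ r < n, (finRotate n ^ (r + 1)) (e a) = e (finRotate m a) ∧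
      ∀ s < r, (finRotate n ^ (s + 1)) (e a) ∉ Set.range e := by
  have han := (e a).2
  by_cases ha : (a : ℕ) + 1 < m
  · have hlt : a < finRotate m a := by
      rw [Fin.lt_def, val_finRotate, Nat.mod_eq_of_lt ha]; omega
    have hlt' : (e a : ℕ) < e (finRotate m a) := e.strictMono hlt
    have hbn := (e (finRotate m a)).2
    refine ⟨e (finRotate m a) - e a - 1, by omega, Fin.ext ?_, ?_⟩
    · rw [val_finRotate_pow, Nat.mod_eq_of_lt (by omega)]; omega
    · rintro s hs ⟨b, hb⟩
      have hb' : (e b : ℕ) = e a + (s + 1) := by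
        rw [hb, val_finRotate_pow, Nat.mod_eq_of_lt (by omega)]
      have h1 : e a < e b := by rw [Fin.lt_def]; omega
      have h2 : e b < e (finRotate m a) := by rw [Fin.lt_def]; omega
      rw [e.lt_iff_lt, Fin.lt_def] at h1 h2
      rw [val_finRotate, Nat.mod_eq_of_lt ha] at h2
      omega
  · have ham : (a : ℕ) + 1 = m := by omega
    have h0 : (finRotate m a : ℕ) = 0 := by rw [val_finRotate, ham, Nat.mod_self]
    have hle : (e (finRotate m a) : ℕ) ≤ e a :=
      Fin.le_def.1 (e.monotone (by rw [Fin.le_def]; omega))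
    refine ⟨e (finRotate m a) + n - e a - 1, by omega, Fin.ext ?_, ?_⟩
    · rw [val_finRotate_pow, show (e a : ℕ) + (e (finRotate m a) + n - e a - 1 + 1)
        = e (finRotate m a) + n by omega, Nat.add_mod_right, Nat.mod_eq_of_lt (by omega)]
    · rintro s hs ⟨b, hb⟩
      have hb' := congrArg Fin.val hb
      rw [val_finRotate_pow] at hb'
      by_cases hn : (e a : ℕ) + (s + 1) < n
      · rw [Nat.mod_eq_of_lt hn] at hb'
        have h1 : e a < e b := by rw [Fin.lt_def]; omega
        rw [e.lt_iff_lt, Fin.lt_def] at h1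
        omega
      · rw [Nat.mod_eq_sub_mod (by omega), Nat.mod_eq_of_lt (by omega)] at hb'
        have h1 : e b < e (finRotate m a) := by rw [Fin.lt_def]; omega
        rw [e.lt_iff_lt, Fin.lt_def] at h1
        omega

theorem exists_finRotate_pow_eq (x y : Fin n) : ∃ s, (finRotate n ^ s) x = y :=
  ⟨y + (n - x), Fin.ext (by
    rw [val_finRotate_pow, show (x : ℕ) + (y + (n - x)) = y + n by omega, Nat.add_mod_right,
      Nat.mod_eq_of_lt y.2])⟩

end Rotation

/-! ### Deleting the fixed points of `ψ = ζ⁻¹ α` -/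

/-- `ψ` acts as `ψ'` on the image of `e` and fixes all other points. -/
structure IsExtension {m n : ℕ} (e : Fin m ↪o Fin n) (ψ : Perm (Fin n)) (ψ' : Perm (Fin m)) :
    Prop where
  apply_emb : ∀ a, ψ (e a) = e (ψ' a)
  fix : ∀ x, x ∉ Set.range e → ψ x = x

namespace IsExtension

variable {m n : ℕ} {e : Fin m ↪o Fin n} {ψ : Perm (Fin n)} {ψ' : Perm (Fin m)}
  (h : IsExtension e ψ ψ')
include h

theorem pow_apply_eq {x y : Fin n} {r : ℕ} (hxy : ψ x = y)
    (hr : ∀ s < r, (finRotate n ^ (s + 1)) y ∉ Set.range e) :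
    ((finRotate n * ψ) ^ (r + 1)) x = (finRotate n ^ (r + 1)) y := by
  induction r with
  | zero => simp [hxy]
  | succ r ih =>
    rw [pow_succ', Perm.mul_apply, ih fun s hs => hr s (by omega), Perm.mul_apply,
      h.fix _ (hr r (by omega)), ← Perm.mul_apply, ← pow_succ']

/-- Outside the image of `e` the permutation `ζ ψ` is just `ζ`, so after one application of `ψ` it
rotates until it meets the image again. -/
theorem firstReturn (a : Fin m) :
    ∃ r < n, ((finRotate n * ψ) ^ (r + 1)) (e a) = e ((finRotate m * ψ') a) ∧
      (∀ s < r, ((finRotate n * ψ) ^ (s + 1)) (e a) ∉ Set.range e) := by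
  obtain ⟨r, hrn, hr, hs⟩ := finRotate_firstReturn e (ψ' a)
  refine ⟨r, hrn, ?_, fun s hsr => ?_⟩
  · rw [h.pow_apply_eq (h.apply_emb a) hs, hr, Perm.mul_apply]
  · rw [h.pow_apply_eq (h.apply_emb a) fun t ht => hs t (by omega)]
    exact hs s hsr

theorem sameCycle_iff (a b : Fin m) :
    (finRotate n * ψ).SameCycle (e a) (e b) ↔ (finRotate m * ψ').SameCycle a b :=
  sameCycle_iff_of_firstReturn e.injective
    (fun b => let ⟨r, _, h1, h2⟩ := h.firstReturn b; ⟨r, h1, h2⟩) a b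

theorem exists_sameCycle [NeZero m] (x : Fin n) :
    ∃ a, (finRotate n * ψ).SameCycle x (e a) := by
  classical
  have hex : ∃ s, (finRotate n ^ s) x ∈ Set.range e :=
    let ⟨s, hs⟩ := exists_finRotate_pow_eq x (e 0); ⟨s, 0, hs.symm⟩
  obtain ⟨a, ha⟩ := Nat.find_spec hex
  refine ⟨a, (sameCycle_iff_exists_pow _ _ _).2 ⟨Nat.find hex, ?_⟩⟩
  rw [ha]
  have key : ∀ s ≤ Nat.find hex, ((finRotate n * ψ) ^ s) x = (finRotate n ^ s) x := by
    intro s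
    induction s with
    | zero => simp
    | succ s ih =>
      intro hs
      rw [pow_succ', Perm.mul_apply, ih (by omega), Perm.mul_apply,
        h.fix _ (Nat.find_min hex (by omega)), ← Perm.mul_apply, ← pow_succ']
  exact key _ le_rfl

theorem numCycles_finRotate_mul [NeZero m] :
    numCycles (finRotate n * ψ) = numCycles (finRotate m * ψ') := by
  choose g hg using h.exists_sameCycle
  refine numCycles_eq_card_of_surjective _
    (fun x => Quotient.mk (Perm.SameCycle.setoid (finRotate m * ψ')) (g x)) ?_ ?_
  · intro c
    obtain ⟨b, rfl⟩ := Quotient.mk_surjective c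
    exact ⟨e b, Quotient.sound ((h.sameCycle_iff _ _).1 (hg (e b)).symm)⟩
  · intro x y
    rw [Quotient.eq (r := Perm.SameCycle.setoid (finRotate m * ψ'))]
    refine (h.sameCycle_iff _ _).symm.trans ⟨fun hxy => ?_, fun hxy => ?_⟩
    · exact (hg x).trans (hxy.trans (hg y).symm)
    · exact (hg x).symm.trans (hxy.trans (hg y))

theorem cycleSet_emb (a : Fin m) : cycleSet ψ (e a) = (cycleSet ψ' a).map e.toEmbedding := by
  have hpow : ∀ i : ℕ, (ψ ^ i) (e a) = e ((ψ' ^ i) a) := by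
    intro i
    induction i with
    | zero => simp
    | succ i ih => rw [pow_succ', Perm.mul_apply, ih, h.apply_emb, ← Perm.mul_apply, ← pow_succ']
  ext y
  simp only [mem_cycleSet, mem_map, sameCycle_iff_exists_pow]
  constructor
  · rintro ⟨i, rfl⟩
    exact ⟨_, ⟨i, rfl⟩, (hpow i).symm⟩
  · rintro ⟨_, ⟨i, rfl⟩, rfl⟩
    exact ⟨i, hpow i⟩

theorem numCycles_eq : numCycles ψ + m = n + numCycles ψ' := by
  classical
  have hsum := sum_inv_card_cycleSet ψ
  rw [← Finset.sum_add_sum_compl (univ.map e.toEmbedding), Finset.sum_map] at hsum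
  have h1 : ∑ a, ((#(cycleSet ψ (e.toEmbedding a)) : ℚ))⁻¹ = numCycles ψ' := by
    rw [← sum_inv_card_cycleSet]
    refine Finset.sum_congr rfl fun a _ => ?_
    have := h.cycleSet_emb a
    simp only [RelEmbedding.coe_toEmbedding, this, card_map]
  have h2 : ∑ x ∈ (univ.map e.toEmbedding)ᶜ, ((#(cycleSet ψ x) : ℚ))⁻¹ = (n - m : ℚ) := by
    have : ∀ x ∈ (univ.map e.toEmbedding)ᶜ, ((#(cycleSet ψ x) : ℚ))⁻¹ = 1 := by
      intro x hx
      have hx' : ψ x = x := h.fix x (by simpa using hx)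
      have h3 := card_cycleSet_le (p := 1) one_pos (by simpa using hx')
      have h4 := Finset.card_pos.2 ⟨x, self_mem_cycleSet ψ x⟩
      rw [le_antisymm h3 h4]; simp
    rw [Finset.sum_congr rfl this, sum_const, card_compl, card_map, card_univ, Fintype.card_fin,
      Fintype.card_fin, nsmul_eq_mul, mul_one, Nat.cast_sub]
    simpa using Fintype.card_le_of_embedding e.toEmbedding
  rw [h1, h2] at hsum
  have : (numCycles ψ : ℚ) + m = n + numCycles ψ' := by linarith
  exact_mod_cast this

theorem card_filter_lt : #(univ.filter fun i => ψ i < i) = #(univ.filter fun a => ψ' a < a) := by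
  rw [← card_map e.toEmbedding]
  congr 1
  ext x
  simp only [mem_filter, mem_univ, true_and, mem_map, RelEmbedding.coe_toEmbedding]
  constructor
  · intro hx
    by_cases hr : x ∈ Set.range e
    · obtain ⟨a, rfl⟩ := hr
      rw [h.apply_emb, e.lt_iff_lt] at hx
      exact ⟨a, hx, rfl⟩
    · rw [h.fix x hr] at hx
      exact absurd hx (lt_irrefl x)
  · rintro ⟨a, ha, rfl⟩
    rwa [h.apply_emb, e.lt_iff_lt]

/-- Along a trivial cycle `ζ ψ` agrees with `ζ` except at the last point, so only that point can lie
in the image of `e`; it is then fixed by the first return map. -/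
theorem hasTrivialCycle_iff [NeZero m] (hfix : ∀ a, ψ' a ≠ a) :
    HasTrivialCycle (finRotate n * ψ) ↔ ∃ a, (finRotate m * ψ') a = a := by
  have hmem : ∀ x, (finRotate n * ψ) x = finRotate n x → x ∉ Set.range e := by
    rintro _ hx ⟨a, rfl⟩
    rw [Perm.mul_apply, h.apply_emb] at hx
    exact hfix a (e.injective ((finRotate n).injective hx))
  constructor
  · rintro ⟨i, p, hp, hstep, hlast⟩
    have hout : ∀ t < p, (finRotate n ^ t) i ∉ Set.range e := by
      intro t ht
      refine hmem _ ?_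
      rw [hstep t ht, pow_succ', Perm.mul_apply]
    by_cases hr : (finRotate n ^ p) i ∈ Set.range e
    · obtain ⟨a, ha⟩ := hr
      obtain ⟨r, hrn, hr, hs⟩ := h.firstReturn a
      have hpow : ∀ t ≤ p, ((finRotate n * ψ) ^ (t + 1)) (e a) = (finRotate n ^ t) i := by
        intro t
        induction t with
        | zero => intro _; rw [zero_add, pow_one, ha, hlast]; simp
        | succ t ih =>
          intro ht
          rw [pow_succ', Perm.mul_apply, ih (by omega), hstep t (by omega)]
      refine ⟨a, e.injective ?_⟩
      rcases lt_trichotomy r p with hlt | rfl | hlt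
      · rw [hpow r hlt.le] at hr
        exact absurd ⟨_, hr.symm⟩ (hout r hlt)
      · rw [← hr, hpow r le_rfl, ha]
      · exact absurd ⟨a, by rw [hpow p le_rfl, ha]⟩ (hs p hlt)
    -- If the last point is also outside the image, the cycle is the whole circle and must contain
    -- `e 0`, a contradiction.
    · rw [Perm.mul_apply, h.fix _ hr, ← Perm.mul_apply, ← pow_succ'] at hlast
      have hv := congrArg Fin.val hlast
      rw [val_finRotate_pow] at hv
      have hpn : p + 1 = n := by
        by_contra hne
        by_cases hlt : (i : ℕ) + (p + 1) < n
        · rw [Nat.mod_eq_of_lt hlt] at hv; omega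
        · have := i.2
          rw [Nat.mod_eq_sub_mod (by omega), Nat.mod_eq_of_lt (by omega)] at hv
          omega
      obtain ⟨s, hs⟩ := exists_finRotate_pow_eq i (e 0)
      have hs' : (finRotate n ^ (s % n)) i = e 0 := by
        rw [← hs]
        exact Fin.ext (by rw [val_finRotate_pow, val_finRotate_pow, Nat.add_mod_mod])
      have hsn := Nat.mod_lt s (show 0 < n by omega)
      rcases (show s % n < p ∨ s % n = p by omega) with hlt | heq
      · exact absurd ⟨0, hs'.symm⟩ (hout _ hlt)
      · exact absurd ⟨0, by rw [← heq, hs']⟩ hr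
  · rintro ⟨a, ha⟩
    obtain ⟨r, hrn, hr, hs⟩ := finRotate_firstReturn e (ψ' a)
    have hadd : ∀ t, (finRotate n ^ t) (finRotate n (e (ψ' a))) =
        (finRotate n ^ (t + 1)) (e (ψ' a)) := fun t => by rw [pow_succ, Perm.mul_apply]
    rw [← Perm.mul_apply, ha] at hr
    refine ⟨finRotate n (e (ψ' a)), r, hrn, fun t ht => ?_, ?_⟩
    · rw [hadd, Perm.mul_apply, h.fix _ (hs t ht), ← Perm.mul_apply, ← pow_succ', hadd]
    · rw [hadd, hr, Perm.mul_apply, h.apply_emb]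

end IsExtension

/-- The extra element is the point that `ψ` sends to `n - 1`, where the rotation wraps around to 0.
-/
theorem card_antiexc_finRotate_mul {n : ℕ} [NeZero n] (ψ : Perm (Fin n)) :
    #(antiexc (finRotate n * ψ)) = #(univ.filter fun i => ψ i < i) + 1 := by
  classical
  have hn : 0 < n := Nat.pos_of_neZero n
  let l : Fin n := ⟨n - 1, by omega⟩
  have : antiexc (finRotate n * ψ) = insert (ψ.symm l) (univ.filter fun i => ψ i < i) := by
    ext i
    simp only [mem_antiexc, mem_insert, mem_filter, mem_univ, true_and, Equiv.eq_symm_apply,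
      Perm.mul_apply, Fin.le_def, Fin.lt_def, val_finRotate, Fin.ext_iff, l]
    have h1 := (ψ i).2
    have h2 := i.2
    rcases (show (ψ i : ℕ) + 1 < n ∨ (ψ i : ℕ) + 1 = n by omega) with h | h
    · rw [Nat.mod_eq_of_lt h]; omega
    · rw [h, Nat.mod_self]; omega
  rw [this, card_insert_of_notMem]
  simp only [mem_filter, mem_univ, true_and, Equiv.apply_symm_apply, Fin.lt_def, l]
  have := (ψ.symm l).2
  omega

/-! ### Extremal cycle counts: fixed-point-free involutions -/

section Involution

variable {m : ℕ}

theorem numCycles_le_half {α : Perm (Fin m)} (h : ∀ a, α a ≠ a) : 2 * numCycles α ≤ m := by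
  have hle : (numCycles α : ℚ) ≤ ∑ _a : Fin m, (2 : ℚ)⁻¹ := by
    rw [← sum_inv_card_cycleSet]
    refine Finset.sum_le_sum fun a _ => ?_
    have : (2 : ℚ) ≤ #(cycleSet α a) := by exact_mod_cast two_le_card_cycleSet (h a)
    gcongr
  rw [sum_const, card_univ, Fintype.card_fin, nsmul_eq_mul] at hle
  have : (2 * numCycles α : ℚ) ≤ m := by linarith
  exact_mod_cast this

theorem two_mul_numCycles_of_involution {α : Perm (Fin m)} (h : ∀ a, α a ≠ a)
    (h2 : ∀ a, α (α a) = a) : 2 * numCycles α = m := by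
  have heq : (numCycles α : ℚ) = ∑ _a : Fin m, (2 : ℚ)⁻¹ := by
    rw [← sum_inv_card_cycleSet]
    refine Finset.sum_congr rfl fun a _ => ?_
    rw [le_antisymm (card_cycleSet_le two_pos (by simpa [sq] using h2 a))
      (two_le_card_cycleSet (h a))]
    simp
  rw [sum_const, card_univ, Fintype.card_fin, nsmul_eq_mul] at heq
  have : (2 * numCycles α : ℚ) = m := by linarith
  exact_mod_cast this

theorem involution_of_two_mul_numCycles {α : Perm (Fin m)} (h : ∀ a, α a ≠ a)
    (hm : 2 * numCycles α = m) (a : Fin m) : α (α a) = a := by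
  by_contra hne
  have hlt : (numCycles α : ℚ) < ∑ _a : Fin m, (2 : ℚ)⁻¹ := by
    rw [← sum_inv_card_cycleSet]
    refine Finset.sum_lt_sum (fun a _ => ?_) ⟨a, mem_univ a, ?_⟩
    · have : (2 : ℚ) ≤ #(cycleSet α a) := by exact_mod_cast two_le_card_cycleSet (h a)
      gcongr
    · have : (3 : ℚ) ≤ #(cycleSet α a) := by
        exact_mod_cast three_le_card_cycleSet (h a) hne
      gcongr
      linarith
  rw [sum_const, card_univ, Fintype.card_fin, nsmul_eq_mul] at hlt
  have : (2 * numCycles α : ℚ) < m := by linarith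
  have hm' : (2 * numCycles α : ℚ) = m := by exact_mod_cast hm
  exact this.ne hm'

/-- The involution exchanges the anti-excedances with their complement. -/
theorem two_mul_card_antiexc_of_involution {α : Perm (Fin m)} (h : ∀ a, α a ≠ a)
    (h2 : ∀ a, α (α a) = a) : 2 * #(antiexc α) = m := by
  have hc : #(antiexc α)ᶜ = #(antiexc α) := by
    rw [← card_map α.toEmbedding]
    congr 1
    ext x
    simp only [mem_map_equiv, mem_compl, mem_antiexc, not_le]
    have hs : α.symm x = α x := by rw [Equiv.symm_apply_eq, h2]
    rw [hs, h2]
    exact ⟨fun hx => hx.le, fun hx => lt_of_le_of_ne hx (h x)⟩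
  have := card_add_card_compl (antiexc α)
  rw [hc, Fintype.card_fin] at this
  omega

end Involution

/-! ### Reduction to pairings on `2 k` points -/

/-- The conditions on the permutation `α_P` of a reduced partition of genus one with `k` blocks. -/
structure IsReducedGenusOne {n : ℕ} (k : ℕ) (α : Perm (Fin n)) : Prop where
  card_antiexc : #(antiexc α) = numCycles α
  numCycles_eq : numCycles α = k
  hasGenus : HasGenus α 1
  isReduced : IsReduced α

/-- `ζ ψ` is a pairing without pairs of neighbours, and `ψ` has `k - 1` cycles. -/
structure IsGenusOnePairing {m : ℕ} (k : ℕ) (ψ : Perm (Fin m)) : Prop where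
  apply_ne : ∀ a, ψ a ≠ a
  pair_ne : ∀ a, (finRotate m * ψ) a ≠ a
  involutive : ∀ a, (finRotate m * ψ) ((finRotate m * ψ) a) = a
  numCycles_eq : numCycles ψ + 1 = k

theorem hasGenus_finRotate_mul {n : ℕ} (ψ : Perm (Fin n)) (g : ℕ) :
    HasGenus (finRotate n * ψ) g ↔
      (n : ℤ) + 1 - 2 * g = numCycles (finRotate n * ψ) + numCycles ψ := by
  rw [HasGenus, mul_inv_rev, inv_mul_cancel_right, numCycles_inv]

theorem IsExtension.isReducedGenusOne_iff {m n k : ℕ} {e : Fin m ↪o Fin n} {ψ : Perm (Fin n)}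
    {ψ' : Perm (Fin m)} (h : IsExtension e ψ ψ') (hfix : ∀ a, ψ' a ≠ a) :
    IsReducedGenusOne k (finRotate n * ψ) ↔ m = 2 * k ∧ IsGenusOnePairing k ψ' := by
  have hψ := h.numCycles_eq
  rcases Nat.eq_zero_or_pos m with rfl | hm
  · have h0 : numCycles ψ' = 0 := by have := numCycles_le_half hfix; omega
    constructor
    · intro hr
      have hg := (hasGenus_finRotate_mul _ _).1 hr.hasGenus
      push_cast at hg
      omega
    · rintro ⟨hk, hp⟩
      have := hp.numCycles_eq
      omega
  have : NeZero m := ⟨hm.ne'⟩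
  have : NeZero n := ⟨((e 0).pos).ne'⟩
  have hz := h.numCycles_finRotate_mul
  have hanti : #(antiexc (finRotate n * ψ)) = #(antiexc (finRotate m * ψ')) := by
    rw [card_antiexc_finRotate_mul, card_antiexc_finRotate_mul, h.card_filter_lt]
  have hanti' : #(antiexc (finRotate m * ψ')) = #(antiexc ψ') + 1 := by
    rw [card_antiexc_finRotate_mul]
    congr 2
    ext a
    simp only [antiexc, mem_filter, mem_univ, true_and]
    exact ⟨le_of_lt, fun ha => lt_of_le_of_ne ha (hfix a)⟩
  have hred := h.hasTrivialCycle_iff hfix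
  constructor
  · intro hr
    have hg := (hasGenus_finRotate_mul _ _).1 hr.hasGenus
    have hne : ∀ a, (finRotate m * ψ') a ≠ a := fun a ha => hr.isReduced (hred.2 ⟨a, ha⟩)
    have h1 := numCycles_le_half hne
    have h2 := numCycles_le_card_antiexc ψ'
    have h3 := hr.card_antiexc
    have h4 := hr.numCycles_eq
    push_cast at hg
    -- The genus gives `z(ψ') = m - 1 - k`; anti-excedances give `k ≥ z(ψ') + 1`, and `h1` is `2 k ≤
    -- m`.
    have hmk : m = 2 * k := by omega
    exact ⟨hmk, hfix, hne, involution_of_two_mul_numCycles hne (by omega), by omega⟩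
  · rintro ⟨hmk, hp⟩
    have h1 := two_mul_numCycles_of_involution hp.pair_ne hp.involutive
    have h2 := two_mul_card_antiexc_of_involution hp.pair_ne hp.involutive
    have h3 := hp.numCycles_eq
    refine ⟨by omega, by omega, (hasGenus_finRotate_mul _ _).2 ?_, fun ht => ?_⟩
    · push_cast
      omega
    · obtain ⟨a, ha⟩ := hred.1 ht
      exact hp.pair_ne a ha

theorem isExtension_viaEmbedding {m n : ℕ} (e : Fin m ↪o Fin n) (ψ' : Perm (Fin m)) :
    IsExtension e (ψ'.viaEmbedding e.toEmbedding) ψ' :=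
  ⟨fun a => ψ'.viaEmbedding_apply e.toEmbedding a,
    fun x hx => ψ'.viaEmbedding_apply_of_notMem e.toEmbedding x hx⟩

theorem exists_isExtension {m n : ℕ} (e : Fin m ↪o Fin n) (ψ : Perm (Fin n))
    (hs : ∀ x, x ∈ Set.range e ↔ ψ x ≠ x) :
    ∃ ψ', IsExtension e ψ ψ' ∧ ∀ a, ψ' a ≠ a := by
  have hmem : ∀ a, ∃ b, e b = ψ (e a) := fun a =>
    (hs _).2 fun he => (hs _).1 ⟨a, rfl⟩ (ψ.injective he)
  choose f hf using hmem
  have hinj : Function.Injective f := fun a b hab =>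
    e.injective (ψ.injective (by rw [← hf, ← hf, hab]))
  refine ⟨Equiv.ofBijective f (Finite.injective_iff_bijective.1 hinj), ⟨?_, ?_⟩, ?_⟩
  · intro a
    exact (hf a).symm
  · intro x hx
    by_contra hne
    exact hx ((hs x).2 hne)
  · intro a ha
    have ha' : f a = a := ha
    refine (hs _).1 ⟨a, rfl⟩ ?_
    rw [← hf, ha']

theorem r₀_eq_card (n k : ℕ) :
    r₀ n k = Nat.card {ψ : Perm (Fin n) // IsReducedGenusOne k (finRotate n * ψ)} := by
  have h1 : r₀ n k = Nat.card {α : Perm (Fin n) // IsReducedGenusOne k α} := by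
    refine Nat.card_congr (Equiv.ofBijective
      (fun P => ⟨partitionPerm P.1, card_antiexc_partitionPerm P.1,
        (numCycles_partitionPerm P.1).trans P.2.1, P.2.2.1, P.2.2.2⟩) ⟨?_, ?_⟩)
    · intro P Q h
      exact Subtype.ext (partitionPerm_injective (Subtype.ext_iff.1 h))
    · rintro ⟨α, hα⟩
      obtain ⟨P, rfl⟩ := exists_partitionPerm_eq hα.card_antiexc
      exact ⟨⟨P, (numCycles_partitionPerm P).symm.trans hα.numCycles_eq, hα.hasGenus,
        hα.isReduced⟩, rfl⟩
  rw [h1]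
  refine Nat.card_congr (Equiv.subtypeEquiv (Equiv.mulLeft (finRotate n)⁻¹) fun α => ?_)
  simp

/-- Sort the permutations `ψ` by support, which must have `2 k` elements; those with a given support
correspond to the pairings. -/
theorem r₀_eq_choose_mul (n k : ℕ) :
    r₀ n k = n.choose (2 * k) *
      Nat.card {ψ : Perm (Fin (2 * k)) // IsGenusOnePairing k ψ} := by
  classical
  rw [r₀_eq_card]
  have hrange : ∀ {m : ℕ} (S : Finset (Fin n)) (hS : #S = m) (ψ : Perm (Fin n)),
      ψ.support = S → ∀ x, x ∈ Set.range (S.orderEmbOfFin hS) ↔ ψ x ≠ x := by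
    rintro m S hS ψ rfl x
    rw [range_orderEmbOfFin]
    simp
  rw [Nat.card_eq_fintype_card, Fintype.card_subtype,
    Finset.card_eq_sum_card_fiberwise (f := fun ψ : Perm (Fin n) => ψ.support)
      (t := powersetCard (2 * k) univ)]
  · rw [Finset.sum_congr rfl (g := fun _ =>
      Nat.card {ψ : Perm (Fin (2 * k)) // IsGenusOnePairing k ψ}), sum_const, card_powersetCard,
      card_univ, Fintype.card_fin, smul_eq_mul]
    intro S hS
    have hS := (mem_powersetCard.1 hS).2
    rw [Nat.card_eq_fintype_card, Fintype.card_subtype]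
    symm
    refine Finset.card_bij
      (fun ψ' _ => ψ'.viaEmbedding (S.orderEmbOfFin hS).toEmbedding) ?_ ?_ ?_
    · intro ψ' hψ'
      have hψ' := (mem_filter.1 hψ').2
      have hext := isExtension_viaEmbedding (S.orderEmbOfFin hS) ψ'
      simp only [mem_filter, mem_univ, true_and]
      refine ⟨(hext.isReducedGenusOne_iff hψ'.apply_ne).2 ⟨rfl, hψ'⟩, ?_⟩
      ext x
      rw [Perm.mem_support, ← mem_coe, ← range_orderEmbOfFin S hS]
      constructor
      · intro hx
        by_contra hr
        exact hx (hext.fix x hr)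
      · rintro ⟨a, rfl⟩
        rw [hext.apply_emb]
        exact fun ha => hψ'.apply_ne a ((S.orderEmbOfFin hS).injective ha)
    · intro ψ₁ _ ψ₂ _ h
      refine Equiv.ext fun a => (S.orderEmbOfFin hS).injective ?_
      rw [← (isExtension_viaEmbedding _ ψ₁).apply_emb, ← (isExtension_viaEmbedding _ ψ₂).apply_emb,
        h]
    · intro ψ hψ
      simp only [mem_filter, mem_univ, true_and] at hψ
      obtain ⟨ψ', hext, hne⟩ := exists_isExtension (S.orderEmbOfFin hS) ψ (hrange S hS ψ hψ.2)
      refine ⟨ψ', by simpa using ((hext.isReducedGenusOne_iff hne).1 hψ.1).2, ?_⟩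
      refine Equiv.ext fun x => ?_
      by_cases hx : x ∈ Set.range (S.orderEmbOfFin hS)
      · obtain ⟨a, rfl⟩ := hx
        rw [hext.apply_emb, (isExtension_viaEmbedding _ ψ').apply_emb]
      · rw [hext.fix x hx, (isExtension_viaEmbedding _ ψ').fix x hx]
  · intro ψ hψ
    simp only [coe_filter, mem_univ, true_and, Set.mem_ofPred_eq] at hψ
    obtain ⟨ψ', hext, hne⟩ := exists_isExtension (ψ.support.orderEmbOfFin rfl) ψ
      (hrange _ rfl ψ rfl)
    rw [mem_coe, mem_powersetCard]
    exact ⟨subset_univ _, ((hext.isReducedGenusOne_iff hne).1 hψ).1⟩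

/-! ### Matchings of at most six pieces -/

section FiniteCheck

theorem no_involution_of_card_three (ρ : Fin 3 → Fin 3) (h1 : ∀ a, ρ (ρ a) = a)
    (h2 : ∀ a, ρ a ≠ a) : False := by
  revert ρ
  decide +kernel

theorem no_involution_of_card_five (ρ : Fin 5 → Fin 5) (h1 : ∀ a, ρ (ρ a) = a)
    (h2 : ∀ a, ρ a ≠ a) : False := by
  revert ρ
  decide +kernel

theorem antipodal_of_card_four (ρ : Fin 4 → Fin 4) (h1 : ∀ a, ρ (ρ a) = a) (h2 : ∀ a, ρ a ≠ a)
    (h3 : ∀ a, ρ a + 1 ≠ a) (a : Fin 4) : ρ a = a + 2 := by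
  revert ρ a
  decide +kernel

theorem antipodal_of_card_six (ρ : Fin 6 → Fin 6) (h1 : ∀ a, ρ (ρ a) = a) (h2 : ∀ a, ρ a ≠ a)
    (h3 : ∀ a, ρ a + 1 ≠ a) (h4 : ∀ a, ρ (ρ a + 1) + 1 ≠ a) (a : Fin 6) : ρ a = a + 3 := by
  -- The values are quantified one at a time, so that forbidden ones are discarded before the next
  -- is enumerated.
  have key : ∀ r0 : Fin 6, r0 ≠ 0 → r0 + 1 ≠ 0 → ∀ r1 : Fin 6, r1 ≠ 1 → r1 + 1 ≠ 1 →
      ∀ r2 : Fin 6, r2 ≠ 2 → r2 + 1 ≠ 2 → ∀ r3 : Fin 6, r3 ≠ 3 → r3 + 1 ≠ 3 →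
      ∀ r4 : Fin 6, r4 ≠ 4 → r4 + 1 ≠ 4 → ∀ r5 : Fin 6, r5 ≠ 5 → r5 + 1 ≠ 5 →
      (∀ a, ![r0, r1, r2, r3, r4, r5] (![r0, r1, r2, r3, r4, r5] a) = a) →
      (∀ a, ![r0, r1, r2, r3, r4, r5] (![r0, r1, r2, r3, r4, r5] a + 1) + 1 ≠ a) →
      ∀ a, ![r0, r1, r2, r3, r4, r5] a = a + 3 := by
    decide +kernel
  have e : ρ = ![ρ 0, ρ 1, ρ 2, ρ 3, ρ 4, ρ 5] := by
    ext i
    fin_cases i <;> rfl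
  have := key _ (h2 0) (h3 0) _ (h2 1) (h3 1) _ (h2 2) (h3 2) _ (h2 3) (h3 3) _ (h2 4) (h3 4)
    _ (h2 5) (h3 5)
  rw [← e] at this
  exact this h1 h4 a

end FiniteCheck

/-! ### Breaks, and the pieces between them -/

/-- The points which are not on a cycle of length at most two of `φ`. -/
def breaks {N : ℕ} (φ : Perm (Fin N)) : Finset (Fin N) := univ.filter fun x => φ (φ x) ≠ x

theorem mem_breaks {N : ℕ} {φ : Perm (Fin N)} {x : Fin N} :
    x ∈ breaks φ ↔ φ (φ x) ≠ x := by
  simp [breaks]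

theorem apply_mem_breaks {N : ℕ} {φ : Perm (Fin N)} {x : Fin N} :
    φ x ∈ breaks φ ↔ x ∈ breaks φ := by
  simp only [mem_breaks]
  exact not_congr φ.apply_eq_iff_eq

/-- By `sum_inv_card_cycleSet`, the sum of `1/2 - 1/ℓ(x)` over the breaks is 1, where `ℓ(x) ≥ 3` is
the cycle length. Each term is at least `1/6` and less than `1/2`. -/
theorem card_breaks {N : ℕ} {φ : Perm (Fin N)} (hφ : ∀ x, φ x ≠ x)
    (hN : N = 2 * (numCycles φ + 1)) : 3 ≤ #(breaks φ) ∧ #(breaks φ) ≤ 6 := by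
  classical
  have hsum := sum_inv_card_cycleSet φ
  rw [← Finset.sum_add_sum_compl (breaks φ)] at hsum
  have h2 : ∑ x ∈ (breaks φ)ᶜ, ((#(cycleSet φ x) : ℚ))⁻¹ = (N - #(breaks φ)) / 2 := by
    have : ∀ x ∈ (breaks φ)ᶜ, ((#(cycleSet φ x) : ℚ))⁻¹ = 2⁻¹ := by
      intro x hx
      rw [mem_compl, mem_breaks, not_not] at hx
      rw [le_antisymm (card_cycleSet_le two_pos (by simpa [sq] using hx))
        (two_le_card_cycleSet (hφ x))]
      simp
    have hle : #(breaks φ) ≤ N := by simpa using card_le_univ (breaks φ)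
    rw [Finset.sum_congr rfl this, sum_const, card_compl, Fintype.card_fin, nsmul_eq_mul,
      Nat.cast_sub hle]
    ring
  have h1 : ∑ x ∈ breaks φ, ((#(cycleSet φ x) : ℚ))⁻¹ ≤ #(breaks φ) / 3 := by
    have : ∀ x ∈ breaks φ, ((#(cycleSet φ x) : ℚ))⁻¹ ≤ 3⁻¹ := by
      intro x hx
      have : (3 : ℚ) ≤ #(cycleSet φ x) := by
        exact_mod_cast three_le_card_cycleSet (hφ x) (mem_breaks.1 hx)
      gcongr
    calc _ ≤ _ := Finset.sum_le_sum this
      _ = _ := by rw [sum_const, nsmul_eq_mul]; ring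
  have h0 : 0 ≤ ∑ x ∈ breaks φ, ((#(cycleSet φ x) : ℚ))⁻¹ :=
    Finset.sum_nonneg fun x _ => by positivity
  have hN' : (N : ℚ) = 2 * (numCycles φ + 1) := by exact_mod_cast hN
  constructor
  · by_contra hlt
    have hge : (2 : ℚ) ≤ #(breaks φ) := by linarith
    have hge' : 2 ≤ #(breaks φ) := by exact_mod_cast hge
    have h3 : #(breaks φ) = 2 := by omega
    have hpos : 0 < ∑ x ∈ breaks φ, ((#(cycleSet φ x) : ℚ))⁻¹ := by
      refine Finset.sum_pos (fun x _ => ?_) (Finset.card_pos.1 (by omega))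
      have := Finset.card_pos.2 ⟨x, self_mem_cycleSet φ x⟩
      positivity
    have h3' : (#(breaks φ) : ℚ) = 2 := by exact_mod_cast h3
    linarith
  · have : (#(breaks φ) : ℚ) ≤ 6 := by linarith
    exact_mod_cast this

section Pieces

variable {N : ℕ} {τ φ : Perm (Fin N)}

theorem finRotate_pow_succ_apply (t : ℕ) (x : Fin N) :
    finRotate N ((finRotate N ^ t) x) = (finRotate N ^ (t + 1)) x := by
  rw [pow_succ', Perm.mul_apply]

theorem finRotate_pow_succ_apply' (t : ℕ) (x : Fin N) :
    (finRotate N ^ t) (finRotate N x) = (finRotate N ^ (t + 1)) x := by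
  rw [pow_succ, Perm.mul_apply]

/-- At a non-break the chords of `τ` at two neighbouring points are parallel: one step forward at
one end is one step back at the other. -/
theorem pow_apply_reverse (hφ : ∀ x, φ x = τ (finRotate N x)) (hτ : ∀ x, τ (τ x) = x)
    {x : Fin N} {t : ℕ} (h : ∀ s < t, (finRotate N ^ (s + 1)) x ∉ breaks φ) :
    (finRotate N ^ t) (φ ((finRotate N ^ t) x)) = φ x := by
  induction t with
  | zero => simp
  | succ t ih =>
    rw [← ih fun s hs => h s (by omega), ← finRotate_pow_succ_apply']
    congr 1
    have ht := h t (by omega)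
    rw [mem_breaks, not_not, hφ (φ _)] at ht
    rw [← hτ (finRotate N _), ht, hφ ((finRotate N ^ t) x), finRotate_pow_succ_apply]

/-- Piece `a` consists of the `L a` points after the break `e a`, up to and including the next
break. `τ` reverses it onto piece `ρ a`, so `φ` acts on breaks as `a ↦ ρ a + 1`; the last two
conditions say that this map has no cycle of length one or two. -/
theorem exists_matching_of_pieces (hφ : ∀ x, φ x = τ (finRotate N x)) (hτ : ∀ x, τ (τ x) = x)
    (hne : ∀ x, φ x ≠ x) (hτne : ∀ x, τ x ≠ x) {m : ℕ} (e : Fin m ↪o Fin N)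
    (he : ∀ x, x ∈ Set.range e ↔ x ∈ breaks φ) :
    ∃ (L : Fin m → ℕ) (ρ : Fin m → Fin m),
      (∀ a, 0 < L a ∧ L a ≤ N ∧ (finRotate N ^ L a) (e a) = e (finRotate m a)) ∧
      (∀ a, ∀ t < L a, (finRotate N ^ t) (τ ((finRotate N ^ (t + 1)) (e a))) =
        e (finRotate m (ρ a))) ∧
      (∀ a, L (ρ a) = L a) ∧ (∀ a, ρ (ρ a) = a) ∧ (∀ a, ρ a ≠ a) ∧
      (∀ a, finRotate m (ρ a) ≠ a) ∧
      (∀ a, finRotate m (ρ (finRotate m (ρ a))) ≠ a) := by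
  choose r hrN hr hrs using finRotate_firstReturn e
  have hout : ∀ a, ∀ s < r a, (finRotate N ^ (s + 1)) (e a) ∉ breaks φ := fun a s hs h =>
    hrs a s hs ((he _).2 h)
  have hrev : ∀ a, ∀ t < r a + 1,
      (finRotate N ^ t) (φ ((finRotate N ^ t) (e a))) = φ (e a) := fun a t ht =>
    pow_apply_reverse hφ hτ fun s hs => hout a s (by omega)
  -- The point `p` just before the image of piece `a` is a break, because `φ p` is one.
  have hex : ∀ a, ∃ b, φ (e b) = e (finRotate m a) ∧ (finRotate N ^ (r a + 1)) (e b) = φ (e a) := by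
    intro a
    obtain ⟨p, hp⟩ := (finRotate N ^ (r a + 1)).surjective (φ (e a))
    have h1 : φ ((finRotate N ^ r a) (e a)) = finRotate N p := by
      apply (finRotate N ^ r a).injective
      rw [hrev a (r a) (by omega), finRotate_pow_succ_apply', hp]
    have h2 : φ p = e (finRotate m a) := by
      rw [hφ, ← h1, hφ, finRotate_pow_succ_apply, hr, hτ]
    obtain ⟨b, rfl⟩ := (he p).2 (apply_mem_breaks.1 (h2 ▸ (he _).1 ⟨_, rfl⟩))
    exact ⟨b, h2, hp⟩
  choose ρ hρ1 hρ2 using hex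
  -- Non-final points of the image piece are `φ`-images of non-final points of piece `a`, hence not
  -- breaks.
  have hin : ∀ a, ∀ s < r a, (finRotate N ^ (s + 1)) (e (ρ a)) ∉ Set.range e := by
    intro a s hs hmem
    rw [he] at hmem
    have hq : (finRotate N ^ (s + 1)) (e (ρ a)) = φ ((finRotate N ^ (r a - s)) (e a)) := by
      apply (finRotate N ^ (r a - s)).injective
      rw [hrev a (r a - s) (by omega), ← Perm.mul_apply, ← pow_add,
        show r a - s + (s + 1) = r a + 1 by omega, hρ2]
    rw [hq, apply_mem_breaks, show r a - s = (r a - s - 1) + 1 by omega] at hmem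
    exact hout a _ (by omega) hmem
  have hmemφ : ∀ a, φ (e a) ∈ Set.range e := fun a =>
    (he _).2 (apply_mem_breaks.2 ((he _).1 ⟨a, rfl⟩))
  have hL : ∀ a, r (ρ a) = r a := by
    intro a
    rcases lt_trichotomy (r (ρ a)) (r a) with h | h | h
    · exact absurd ⟨_, (hr (ρ a)).symm⟩ (hin a _ h)
    · exact h
    · exact absurd (hρ2 a ▸ hmemφ a) (hrs (ρ a) _ h)
  have hφe : ∀ a, φ (e a) = e (finRotate m (ρ a)) := fun a => by rw [← hr, hL, hρ2]
  have hρρ : ∀ a, ρ (ρ a) = a := by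
    intro a
    have := (hφe (ρ a)).symm.trans (hρ1 a)
    exact (finRotate m).injective (e.injective this)
  refine ⟨fun a => r a + 1, ρ, fun a => ⟨Nat.succ_pos _, hrN a, hr a⟩,
    fun a t ht => ?_, fun a => congrArg (· + 1) (hL a), hρρ, fun a ha => ?_, fun a ha => ?_, fun a ha => ?_⟩
  · rw [← hφe, ← hrev a t ht, hφ ((finRotate N ^ t) (e a)), finRotate_pow_succ_apply]
  · have h1 : φ (e a) = (finRotate N ^ (r a + 1)) (e a) := by rw [hφe, ha, hr]
    -- A piece reversed onto itself has a middle point fixed by `τ` or a middle pair of neighbours,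
    -- according to the parity of its length `r a + 1`.
    obtain ⟨q, hq | hq⟩ := (r a).even_or_odd'
    · have h2 := hrev a q (by omega)
      rw [h1, hφ, finRotate_pow_succ_apply, show r a + 1 = q + (q + 1) by omega, pow_add _ q (q + 1),
        Perm.mul_apply] at h2
      exact hτne _ ((finRotate N ^ q).injective h2)
    · have h2 := hrev a (q + 1) (by omega)
      rw [h1, show r a + 1 = (q + 1) + (q + 1) by omega, pow_add _ (q + 1) (q + 1),
        Perm.mul_apply] at h2
      exact hne _ ((finRotate N ^ (q + 1)).injective h2)
  · exact hne (e a) (by rw [hφe, ha])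
  · exact mem_breaks.1 ((he _).1 ⟨a, rfl⟩) (by rw [hφe, hφe, ha])

end Pieces

/-! ### Every pairing has the explicit form -/

/-- The circle with `2 k` points is cut after the points `a`, `b`, `c - 1` and their antipodes; the
pairing consists of the reflection of each piece followed by the antipodal map. -/
def reflectPairing (k a b c x : ℕ) : ℕ :=
  if x ≤ a ∨ (c ≤ x ∧ x ≤ a + c) then a + c - x
  else if (a < x ∧ x ≤ b) ∨ (a + k < x ∧ x ≤ b + k) then a + b + 1 + k - x
  else if (b < x ∧ x < c) ∨ (b + k < x ∧ x < c + k) then b + c + k - x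
  else a + c + 2 * k - x

theorem arcLength_eq {N x y l : ℕ} (hx : x < N) (hl : 0 < l) (hlN : l ≤ N)
    (h : (x + l) % N = y) : (x < y ∧ x + l = y) ∨ (y ≤ x ∧ x + l = y + N) := by
  by_cases hlt : x + l < N
  · rw [Nat.mod_eq_of_lt hlt] at h; omega
  · by_cases heq : x + l < N + N
    · rw [Nat.mod_eq_sub_mod (by omega), Nat.mod_eq_of_lt (by omega)] at h; omega
    · omega

theorem add_eq_or_of_add_mod_eq {N x y t : ℕ} (hx : x < N) (ht : t < N)
    (h : (x + t) % N = y) : (x + t < N ∧ x + t = y) ∨ x + t = y + N := by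
  by_cases hlt : x + t < N
  · rw [Nat.mod_eq_of_lt hlt] at h; omega
  · rw [Nat.mod_eq_sub_mod (by omega), Nat.mod_eq_of_lt (by omega)] at h; omega

theorem val_of_piece {N m : ℕ} {τ : Perm (Fin N)} {e : Fin m → Fin N} {L : Fin m → ℕ}
    {σ : Fin m → Fin m}
    (h : ∀ a, ∀ t < L a, (finRotate N ^ t) (τ ((finRotate N ^ (t + 1)) (e a))) = e (σ a))
    (a : Fin m) (t : ℕ) (ht : t < L a) (hL : L a ≤ N) (x : Fin N)
    (hx : (e a : ℕ) + t + 1 = x ∨ (e a : ℕ) + t + 1 = x + N) :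
    ((τ x : ℕ) + t < N ∧ (τ x : ℕ) + t = e (σ a)) ∨ (τ x : ℕ) + t = e (σ a) + N := by
  have hx' : (finRotate N ^ (t + 1)) (e a) = x := by
    apply Fin.ext
    rw [val_finRotate_pow, ← add_assoc]
    rcases hx with hx | hx
    · rw [hx, Nat.mod_eq_of_lt x.2]
    · rw [hx, Nat.add_mod_right, Nat.mod_eq_of_lt x.2]
  have := congrArg Fin.val (h a t ht)
  rw [hx', val_finRotate_pow] at this
  exact add_eq_or_of_add_mod_eq (τ x).2 (by omega) this

set_option maxHeartbeats 1000000 in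
theorem exists_eq_reflectPairing_of_six {k : ℕ} {τ : Perm (Fin (2 * k))}
    {e : Fin 6 ↪o Fin (2 * k)} {L : Fin 6 → ℕ}
    (h1 : ∀ a, 0 < L a ∧ L a ≤ 2 * k ∧ (finRotate (2 * k) ^ L a) (e a) = e (a + 1))
    (h2 : ∀ a, ∀ t < L a, (finRotate (2 * k) ^ t) (τ ((finRotate (2 * k) ^ (t + 1)) (e a))) =
      e (a + 4))
    (h3 : ∀ a, L (a + 3) = L a) :
    ∃ a b c, a < b ∧ b < c ∧ c ≤ k ∧ ∀ x, (τ x : ℕ) = reflectPairing k a b c x := by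
  have hlen : ∀ a, ((e a : ℕ) < e (a + 1) ∧ (e a : ℕ) + L a = e (a + 1)) ∨
      ((e (a + 1) : ℕ) ≤ e a ∧ (e a : ℕ) + L a = e (a + 1) + 2 * k) := by
    intro a
    obtain ⟨hl, hlN, hr⟩ := h1 a
    have := congrArg Fin.val hr
    rw [val_finRotate_pow] at this
    exact arcLength_eq (e a).2 hl hlN this
  have l0 := hlen 0
  have l1 := hlen 1
  have l2 := hlen 2
  have l3 := hlen 3
  have l4 := hlen 4
  have l5 := hlen 5
  have m0 : (e 0 : ℕ) < e 1 := e.strictMono (by decide)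
  have m1 : (e 1 : ℕ) < e 2 := e.strictMono (by decide)
  have m2 : (e 2 : ℕ) < e 3 := e.strictMono (by decide)
  have m3 : (e 3 : ℕ) < e 4 := e.strictMono (by decide)
  have m4 : (e 4 : ℕ) < e 5 := e.strictMono (by decide)
  have m5 := (e 5).2
  have p0 : L 3 = L 0 := h3 0
  have p1 : L 4 = L 1 := h3 1
  have p2 : L 5 = L 2 := h3 2
  simp only [show (0 : Fin 6) + 1 = 1 from rfl, show (1 : Fin 6) + 1 = 2 from rfl,
    show (2 : Fin 6) + 1 = 3 from rfl, show (3 : Fin 6) + 1 = 4 from rfl,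
    show (4 : Fin 6) + 1 = 5 from rfl, show (5 : Fin 6) + 1 = 0 from rfl] at l0 l1 l2 l3 l4 l5
  have q0 : (e 0 : ℕ) + L 0 = e 1 := by omega
  have q1 : (e 1 : ℕ) + L 1 = e 2 := by omega
  have q2 : (e 2 : ℕ) + L 2 = e 3 := by omega
  have q3 : (e 3 : ℕ) + L 3 = e 4 := by omega
  have q4 : (e 4 : ℕ) + L 4 = e 5 := by omega
  have q5 : (e 5 : ℕ) + L 5 = e 0 + 2 * k := by omega
  have e3 : (e 3 : ℕ) = e 0 + k := by omega
  have e4 : (e 4 : ℕ) = e 1 + k := by omega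
  have e5 : (e 5 : ℕ) = e 2 + k := by omega
  -- Opposite pieces have equal lengths, so the breaks come in antipodal pairs.
  refine ⟨e 0, e 1, e 2 + 1, m0, by omega, by omega, fun x => ?_⟩
  clear l0 l1 l2 l3 l4 l5 p0 p1 p2
  have hx := x.2
  have hτx := (τ x).2
  have hv := val_of_piece h2
  rcases (show (x : ℕ) ≤ e 0 ∨ ((e 0 : ℕ) < x ∧ (x : ℕ) ≤ e 1) ∨ ((e 1 : ℕ) < x ∧ (x : ℕ) ≤ e 2) ∨
    ((e 2 : ℕ) < x ∧ (x : ℕ) ≤ e 3) ∨ ((e 3 : ℕ) < x ∧ (x : ℕ) ≤ e 4) ∨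
    ((e 4 : ℕ) < x ∧ (x : ℕ) ≤ e 5) ∨ (e 5 : ℕ) < x by omega) with c | c | c | c | c | c | c
  -- Piece 5 crosses the origin, so it accounts for both the first and the last case.
  · have := hv 5 (x + 2 * k - e 5 - 1) (by omega) (by omega) x (by omega)
    rw [show (5 : Fin 6) + 4 = 3 from rfl] at this
    clear hv
    unfold reflectPairing; split_ifs <;> omega
  · have := hv 0 (x - e 0 - 1) (by omega) (by omega) x (by omega)
    rw [show (0 : Fin 6) + 4 = 4 from rfl] at this
    clear hv
    unfold reflectPairing; split_ifs <;> omega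
  · have := hv 1 (x - e 1 - 1) (by omega) (by omega) x (by omega)
    rw [show (1 : Fin 6) + 4 = 5 from rfl] at this
    clear hv
    unfold reflectPairing; split_ifs <;> omega
  · have := hv 2 (x - e 2 - 1) (by omega) (by omega) x (by omega)
    rw [show (2 : Fin 6) + 4 = 0 from rfl] at this
    clear hv
    unfold reflectPairing; split_ifs <;> omega
  · have := hv 3 (x - e 3 - 1) (by omega) (by omega) x (by omega)
    rw [show (3 : Fin 6) + 4 = 1 from rfl] at this
    clear hv
    unfold reflectPairing; split_ifs <;> omega
  · have := hv 4 (x - e 4 - 1) (by omega) (by omega) x (by omega)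
    rw [show (4 : Fin 6) + 4 = 2 from rfl] at this
    clear hv
    unfold reflectPairing; split_ifs <;> omega
  · have := hv 5 (x - e 5 - 1) (by omega) (by omega) x (by omega)
    rw [show (5 : Fin 6) + 4 = 3 from rfl] at this
    clear hv
    unfold reflectPairing; split_ifs <;> omega

theorem exists_eq_reflectPairing_of_four {k : ℕ} {τ : Perm (Fin (2 * k))}
    {e : Fin 4 ↪o Fin (2 * k)} {L : Fin 4 → ℕ}
    (h1 : ∀ a, 0 < L a ∧ L a ≤ 2 * k ∧ (finRotate (2 * k) ^ L a) (e a) = e (a + 1))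
    (h2 : ∀ a, ∀ t < L a, (finRotate (2 * k) ^ t) (τ ((finRotate (2 * k) ^ (t + 1)) (e a))) =
      e (a + 3))
    (h3 : ∀ a, L (a + 2) = L a) :
    ∃ a b c, a < b ∧ b < c ∧ c ≤ k ∧ ∀ x, (τ x : ℕ) = reflectPairing k a b c x := by
  have hlen : ∀ a, ((e a : ℕ) < e (a + 1) ∧ (e a : ℕ) + L a = e (a + 1)) ∨
      ((e (a + 1) : ℕ) ≤ e a ∧ (e a : ℕ) + L a = e (a + 1) + 2 * k) := by
    intro a
    obtain ⟨hl, hlN, hr⟩ := h1 a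
    have := congrArg Fin.val hr
    rw [val_finRotate_pow] at this
    exact arcLength_eq (e a).2 hl hlN this
  have l0 := hlen 0
  have l1 := hlen 1
  have l2 := hlen 2
  have l3 := hlen 3
  have m0 : (e 0 : ℕ) < e 1 := e.strictMono (by decide)
  have m1 : (e 1 : ℕ) < e 2 := e.strictMono (by decide)
  have m2 : (e 2 : ℕ) < e 3 := e.strictMono (by decide)
  have m3 := (e 3).2
  have p0 : L 2 = L 0 := h3 0
  have p1 : L 3 = L 1 := h3 1
  simp only [show (0 : Fin 4) + 1 = 1 from rfl, show (1 : Fin 4) + 1 = 2 from rfl,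
    show (2 : Fin 4) + 1 = 3 from rfl, show (3 : Fin 4) + 1 = 0 from rfl] at l0 l1 l2 l3
  have q0 : (e 0 : ℕ) + L 0 = e 1 := by omega
  have q1 : (e 1 : ℕ) + L 1 = e 2 := by omega
  have q2 : (e 2 : ℕ) + L 2 = e 3 := by omega
  have q3 : (e 3 : ℕ) + L 3 = e 0 + 2 * k := by omega
  have e2 : (e 2 : ℕ) = e 0 + k := by omega
  have e3 : (e 3 : ℕ) = e 1 + k := by omega
  -- Four pieces are the degenerate case `c = b + 1`, in which the pieces between `b` and `c` are
  -- empty.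
  refine ⟨e 0, e 1, e 1 + 1, m0, by omega, by omega, fun x => ?_⟩
  clear l0 l1 l2 l3 p0 p1
  have hx := x.2
  have hτx := (τ x).2
  have hv := val_of_piece h2
  rcases (show (x : ℕ) ≤ e 0 ∨ ((e 0 : ℕ) < x ∧ (x : ℕ) ≤ e 1) ∨ ((e 1 : ℕ) < x ∧ (x : ℕ) ≤ e 2) ∨
    ((e 2 : ℕ) < x ∧ (x : ℕ) ≤ e 3) ∨ (e 3 : ℕ) < x by omega) with c | c | c | c | c
  · have := hv 3 (x + 2 * k - e 3 - 1) (by omega) (by omega) x (by omega)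
    rw [show (3 : Fin 4) + 3 = 2 from rfl] at this
    clear hv
    unfold reflectPairing; split_ifs <;> omega
  · have := hv 0 (x - e 0 - 1) (by omega) (by omega) x (by omega)
    rw [show (0 : Fin 4) + 3 = 3 from rfl] at this
    clear hv
    unfold reflectPairing; split_ifs <;> omega
  · have := hv 1 (x - e 1 - 1) (by omega) (by omega) x (by omega)
    rw [show (1 : Fin 4) + 3 = 0 from rfl] at this
    clear hv
    unfold reflectPairing; split_ifs <;> omega
  · have := hv 2 (x - e 2 - 1) (by omega) (by omega) x (by omega)
    rw [show (2 : Fin 4) + 3 = 1 from rfl] at this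
    clear hv
    unfold reflectPairing; split_ifs <;> omega
  · have := hv 3 (x - e 3 - 1) (by omega) (by omega) x (by omega)
    rw [show (3 : Fin 4) + 3 = 2 from rfl] at this
    clear hv
    unfold reflectPairing; split_ifs <;> omega

theorem IsGenusOnePairing.exists_eq_reflectPairing {k : ℕ} {ψ : Perm (Fin (2 * k))}
    (h : IsGenusOnePairing k ψ) :
    ∃ a b c, a < b ∧ b < c ∧ c ≤ k ∧
      ∀ x, ((finRotate (2 * k) * ψ) x : ℕ) = reflectPairing k a b c x := by
  have hφ : ∀ x, ψ⁻¹ x = (finRotate (2 * k) * ψ) (finRotate (2 * k) x) := by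
    intro x
    rw [Perm.inv_eq_iff_eq]
    apply (finRotate (2 * k)).injective
    have := h.involutive (finRotate (2 * k) x)
    exact this.symm
  have hne : ∀ x, ψ⁻¹ x ≠ x := fun x hx => h.apply_ne x (Perm.inv_eq_iff_eq.1 hx).symm
  have hcard := card_breaks hne (by rw [numCycles_inv, h.numCycles_eq])
  have hmatch := fun {m : ℕ} (hm : #(breaks ψ⁻¹) = m) =>
    exists_matching_of_pieces hφ h.involutive hne h.pair_ne ((breaks ψ⁻¹).orderEmbOfFin hm)
      fun x => by rw [range_orderEmbOfFin, mem_coe]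
  rcases (show #(breaks ψ⁻¹) = 3 ∨ #(breaks ψ⁻¹) = 4 ∨ #(breaks ψ⁻¹) = 5 ∨ #(breaks ψ⁻¹) = 6 by
    omega) with hm | hm | hm | hm
  · obtain ⟨L, ρ, -, -, -, h1, h2, -⟩ := hmatch hm
    exact (no_involution_of_card_three ρ h1 h2).elim
  · obtain ⟨L, ρ, h1, h2, h3, h4, h5, h6, h7⟩ := hmatch hm
    simp only [finRotate_apply] at h1 h2 h6 h7
    have hρ := antipodal_of_card_four ρ h4 h5 h6
    simp only [hρ, add_assoc] at h2 h3
    exact exists_eq_reflectPairing_of_four h1 h2 h3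
  · obtain ⟨L, ρ, -, -, -, h1, h2, -⟩ := hmatch hm
    exact (no_involution_of_card_five ρ h1 h2).elim
  · obtain ⟨L, ρ, h1, h2, h3, h4, h5, h6, h7⟩ := hmatch hm
    simp only [finRotate_apply] at h1 h2 h6 h7
    have hρ := antipodal_of_card_six ρ h4 h5 h6 h7
    simp only [hρ, add_assoc] at h2 h3
    exact exists_eq_reflectPairing_of_six h1 h2 h3

/-! ### Conversely, the explicit pairings have genus one -/

theorem card_cycleSet_eq {n : ℕ} {α : Perm (Fin n)} {x : Fin n} {p : ℕ} (hp : 0 < p)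
    (h : (α ^ p) x = x) (hne : ∀ i, 0 < i → i < p → (α ^ i) x ≠ x) : #(cycleSet α x) = p := by
  refine le_antisymm (card_cycleSet_le hp h) ?_
  rw [← card_range p]
  refine card_le_card_of_injOn (fun i => (α ^ i) x)
    (fun i _ => mem_cycleSet.2 ((sameCycle_iff_exists_pow _ _ _).2 ⟨i, rfl⟩)) ?_
  have key : ∀ i j : ℕ, i < j → j < p → (α ^ i) x ≠ (α ^ j) x := by
    intro i j hij hj he
    refine hne (j - i) (by omega) (by omega) ?_
    apply (α ^ i).injective
    rw [he, ← Perm.mul_apply, ← pow_add, Nat.add_sub_cancel' hij.le]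
  intro i hi j hj hij
  rw [mem_coe, mem_range] at hi hj
  rcases lt_trichotomy i j with h | h | h
  · exact absurd hij (key i j h hj)
  · exact h
  · exact absurd hij.symm (key j i h hi)

theorem card_cycleSet_of_three {n : ℕ} {α : Perm (Fin n)} {x y z : Fin n} (h1 : α x = y)
    (h2 : α y = z) (h3 : α z = x) (hy : y ≠ x) (hz : z ≠ x) : #(cycleSet α x) = 3 := by
  refine card_cycleSet_eq three_pos ?_ fun i hi hi' => ?_
  · simp [pow_succ, h1, h2, h3]
  · interval_cases i <;> simpa [pow_succ, h1, h2]

theorem card_cycleSet_of_four {n : ℕ} {α : Perm (Fin n)} {x y z w : Fin n} (h1 : α x = y)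
    (h2 : α y = z) (h3 : α z = w) (h4 : α w = x) (hy : y ≠ x) (hz : z ≠ x) (hw : w ≠ x) :
    #(cycleSet α x) = 4 := by
  refine card_cycleSet_eq four_pos ?_ fun i hi hi' => ?_
  · simp [pow_succ, h1, h2, h3, h4]
  · interval_cases i <;> simpa [pow_succ, h1, h2, h3]

theorem numCycles_eq_of_card_cycleSet {n d : ℕ} {φ : Perm (Fin n)} (D : Finset (Fin n))
    (hD : ∀ x ∈ D, #(cycleSet φ x) = d) (hD' : ∀ x ∉ D, #(cycleSet φ x) = 2) :
    (numCycles φ : ℚ) = #D / d + (n - #D) / 2 := by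
  classical
  have hle : #D ≤ n := by simpa using card_le_univ D
  rw [← sum_inv_card_cycleSet, ← Finset.sum_add_sum_compl D,
    Finset.sum_congr rfl (g := fun _ => (d : ℚ)⁻¹) (fun x hx => by rw [hD x hx]),
    Finset.sum_congr (s₁ := Dᶜ) rfl (g := fun _ => (2 : ℚ)⁻¹)
      (fun x hx => by rw [hD' x (mem_compl.1 hx)]; simp),
    sum_const, sum_const, card_compl, Fintype.card_fin, nsmul_eq_mul, nsmul_eq_mul,
    Nat.cast_sub hle]
  ring

section ReflectPairing

variable {k a b c : ℕ}

theorem reflectPairing_lt (hab : a < b) (hbc : b < c) (hck : c ≤ k) {x : ℕ} (hx : x < 2 * k) :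
    reflectPairing k a b c x < 2 * k := by
  unfold reflectPairing
  split_ifs <;> omega

theorem reflectPairing_reflectPairing (hab : a < b) (hbc : b < c) (hck : c ≤ k) {x : ℕ}
    (hx : x < 2 * k) : reflectPairing k a b c (reflectPairing k a b c x) = x := by
  unfold reflectPairing
  split_ifs <;> omega

theorem reflectPairing_ne (hab : a < b) (hbc : b < c) (hck : c ≤ k) {x : ℕ} :
    reflectPairing k a b c x ≠ x := by
  unfold reflectPairing
  split_ifs <;> omega

theorem reflectPairing_ne_succ (hab : a < b) (hbc : b < c) (hck : c ≤ k) {x : ℕ}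
    (hx : x < 2 * k) : reflectPairing k a b c x ≠ if x + 1 = 2 * k then 0 else x + 1 := by
  unfold reflectPairing
  split_ifs <;> omega

/-- Away from the six cut points neighbouring chords are parallel, so these points lie on 2-cycles
of the face permutation. -/
theorem reflectPairing_parallel (hab : a < b) (hbc : b < c) (hck : c ≤ k) {x y z : ℕ}
    (hx : x < 2 * k) (hxD : x ≠ a ∧ x ≠ b ∧ x + 1 ≠ c ∧ x ≠ a + k ∧ x ≠ b + k ∧ x + 1 ≠ c + k)
    (hy : y = if x + 1 = 2 * k then 0 else x + 1) (hz : z = reflectPairing k a b c y) :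
    reflectPairing k a b c x = if z + 1 = 2 * k then 0 else z + 1 := by
  unfold reflectPairing at *
  split_ifs at * <;> omega

/-- The pairing `reflectPairing` as a permutation. -/
def reflectPerm (hab : a < b) (hbc : b < c) (hck : c ≤ k) : Perm (Fin (2 * k)) :=
  Function.Involutive.toPerm
    (fun x => ⟨reflectPairing k a b c x, reflectPairing_lt hab hbc hck x.2⟩)
    fun x => Fin.ext (reflectPairing_reflectPairing hab hbc hck x.2)

variable (hab : a < b) (hbc : b < c) (hck : c ≤ k)

theorem val_reflectPerm (x : Fin (2 * k)) :
    (reflectPerm hab hbc hck x : ℕ) = reflectPairing k a b c x := rfl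

theorem val_finRotate_eq_ite {n : ℕ} (x : Fin n) :
    (finRotate n x : ℕ) = if (x : ℕ) + 1 = n then 0 else (x : ℕ) + 1 := by
  rw [val_finRotate]
  have := x.2
  split_ifs with h
  · rw [h, Nat.mod_self]
  · rw [Nat.mod_eq_of_lt (by omega)]

theorem reflectPerm_involutive (x : Fin (2 * k)) :
    reflectPerm hab hbc hck (reflectPerm hab hbc hck x) = x :=
  Fin.ext (reflectPairing_reflectPairing hab hbc hck x.2)

/-- The face permutation of `reflectPerm`. -/
def reflectFace : Perm (Fin (2 * k)) := reflectPerm hab hbc hck * finRotate (2 * k)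

theorem reflectFace_apply (x : Fin (2 * k)) :
    reflectFace hab hbc hck x = reflectPerm hab hbc hck (finRotate (2 * k) x) := rfl

theorem reflectFace_apply_eq (x y : Fin (2 * k))
    (h : reflectPairing k a b c (if (x : ℕ) + 1 = 2 * k then 0 else (x : ℕ) + 1) = y) :
    reflectFace hab hbc hck x = y := by
  apply Fin.ext
  rw [← h, ← val_finRotate_eq_ite]
  rfl

theorem reflectFace_ne (x : Fin (2 * k)) : reflectFace hab hbc hck x ≠ x := by
  intro h
  rw [reflectFace_apply] at h
  have h1 : finRotate (2 * k) x = reflectPerm hab hbc hck x := by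
    conv_rhs => rw [← h, reflectPerm_involutive]
  have h2 := congrArg Fin.val h1
  rw [val_finRotate_eq_ite, val_reflectPerm] at h2
  exact reflectPairing_ne_succ hab hbc hck x.2 h2.symm

theorem reflectFace_reflectFace (x : Fin (2 * k))
    (hx : (x : ℕ) ≠ a ∧ (x : ℕ) ≠ b ∧ (x : ℕ) + 1 ≠ c ∧ (x : ℕ) ≠ a + k ∧ (x : ℕ) ≠ b + k ∧
      (x : ℕ) + 1 ≠ c + k) : reflectFace hab hbc hck (reflectFace hab hbc hck x) = x := by
  have h1 : reflectPerm hab hbc hck x = finRotate (2 * k) (reflectFace hab hbc hck x) := by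
    apply Fin.ext
    rw [val_finRotate_eq_ite, val_reflectPerm]
    exact reflectPairing_parallel hab hbc hck x.2 hx (val_finRotate_eq_ite x) rfl
  rw [reflectFace_apply, ← h1, reflectPerm_involutive]

theorem numCycles_reflectFace : numCycles (reflectFace hab hbc hck) + 1 = k := by
  classical
  set φ := reflectFace hab hbc hck with hφ
  let A : Fin (2 * k) := ⟨a, by omega⟩
  let B : Fin (2 * k) := ⟨b, by omega⟩
  let C : Fin (2 * k) := ⟨c - 1, by omega⟩
  let A' : Fin (2 * k) := ⟨a + k, by omega⟩
  let B' : Fin (2 * k) := ⟨b + k, by omega⟩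
  let C' : Fin (2 * k) := ⟨c - 1 + k, by omega⟩
  have h2 : ∀ x, x ≠ A ∧ x ≠ B ∧ x ≠ C ∧ x ≠ A' ∧ x ≠ B' ∧ x ≠ C' → #(cycleSet φ x) = 2 := by
    intro x hx
    simp only [A, B, C, A', B', C', ne_eq, Fin.ext_iff] at hx
    refine le_antisymm (card_cycleSet_le two_pos ?_)
      (two_le_card_cycleSet (reflectFace_ne hab hbc hck x))
    rw [sq, Perm.mul_apply]
    exact reflectFace_reflectFace hab hbc hck x (by omega)
  have hA : φ A = B' := reflectFace_apply_eq hab hbc hck _ _ (by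
    simp only [A, B', reflectPairing]; split_ifs <;> omega)
  have hA' : φ A' = B := reflectFace_apply_eq hab hbc hck _ _ (by
    simp only [A', B, reflectPairing]; split_ifs <;> omega)
  have hC : φ C = A := reflectFace_apply_eq hab hbc hck _ _ (by
    simp only [A, C, reflectPairing]; split_ifs <;> omega)
  have hC' : φ C' = A' := reflectFace_apply_eq hab hbc hck _ _ (by
    simp only [A', C', reflectPairing]; split_ifs <;> omega)
  have hcast : ∀ q : ℚ, (numCycles φ : ℚ) = q → q + 1 = k → numCycles φ + 1 = k := by
    intro q h1 h2
    rw [← h1] at h2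
    exact_mod_cast h2
  -- Either one 4-cycle `A, B', A', B`, or two 3-cycles `A, B', C` and `A', B, C'`. Both `4/4 + (2k
  -- - 4)/2` and `6/3 + (2k - 6)/2` equal `k - 1`.
  by_cases hc : c = b + 1
  · have hCB : C = B := Fin.ext (by simp only [B, C]; omega)
    have hCB' : C' = B' := Fin.ext (by simp only [B', C']; omega)
    rw [hCB] at hC
    rw [hCB'] at hC'
    have hz := numCycles_eq_of_card_cycleSet (φ := φ) (d := 4) {A, B', A', B}
      (by
        simp only [mem_insert, mem_singleton, forall_eq_or_imp, forall_eq]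
        refine ⟨card_cycleSet_of_four hA hC' hA' hC ?_ ?_ ?_,
          card_cycleSet_of_four hC' hA' hC hA ?_ ?_ ?_,
          card_cycleSet_of_four hA' hC hA hC' ?_ ?_ ?_,
          card_cycleSet_of_four hC hA hC' hA' ?_ ?_ ?_⟩ <;>
        · simp only [A, B, A', B', ne_eq, Fin.mk.injEq]
          omega)
      (by
        intro x hx
        simp only [mem_insert, mem_singleton, not_or] at hx
        exact h2 x (by rw [hCB, hCB']; tauto))
    have hcard : #({A, B', A', B} : Finset (Fin (2 * k))) = 4 := by
      repeat rw [card_insert_of_notMem (by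
        simp only [mem_insert, mem_singleton, A, B, A', B', Fin.mk.injEq]; omega)]
      rw [card_singleton]
    rw [hcard] at hz
    refine hcast _ hz ?_
    push_cast
    ring
  · have hB : φ B = C' := reflectFace_apply_eq hab hbc hck _ _ (by
      simp only [B, C', reflectPairing]; split_ifs <;> omega)
    have hB' : φ B' = C := reflectFace_apply_eq hab hbc hck _ _ (by
      simp only [B', C, reflectPairing]; split_ifs <;> omega)
    have hz := numCycles_eq_of_card_cycleSet (φ := φ) (d := 3) {A, B', C, A', B, C'}
      (by
        simp only [mem_insert, mem_singleton, forall_eq_or_imp, forall_eq]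
        refine ⟨card_cycleSet_of_three hA hB' hC ?_ ?_, card_cycleSet_of_three hB' hC hA ?_ ?_,
          card_cycleSet_of_three hC hA hB' ?_ ?_, card_cycleSet_of_three hA' hB hC' ?_ ?_,
          card_cycleSet_of_three hB hC' hA' ?_ ?_, card_cycleSet_of_three hC' hA' hB ?_ ?_⟩ <;>
        · simp only [A, B, C, A', B', C', ne_eq, Fin.mk.injEq]
          omega)
      (by
        intro x hx
        simp only [mem_insert, mem_singleton, not_or] at hx
        exact h2 x (by tauto))
    have hcard : #({A, B', C, A', B, C'} : Finset (Fin (2 * k))) = 6 := by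
      repeat rw [card_insert_of_notMem (by
        simp only [mem_insert, mem_singleton, A, B, C, A', B', C', Fin.mk.injEq]; omega)]
      rw [card_singleton]
    rw [hcard] at hz
    refine hcast _ hz ?_
    push_cast
    ring

theorem isGenusOnePairing_reflectFace_inv :
    finRotate (2 * k) * (reflectFace hab hbc hck)⁻¹ = reflectPerm hab hbc hck ∧
      IsGenusOnePairing k (reflectFace hab hbc hck)⁻¹ := by
  have h : finRotate (2 * k) * (reflectFace hab hbc hck)⁻¹ = reflectPerm hab hbc hck := by
    rw [reflectFace, mul_inv_rev, mul_inv_cancel_left]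
    exact Equiv.ext fun x => by
      rw [Perm.inv_eq_iff_eq, reflectPerm_involutive]
  refine ⟨h, fun x hx => ?_, fun x hx => ?_, fun x => ?_, ?_⟩
  · rw [Perm.inv_eq_iff_eq] at hx
    exact reflectFace_ne hab hbc hck x hx.symm
  · rw [h] at hx
    exact reflectPairing_ne hab hbc hck (congrArg Fin.val hx)
  · rw [h, reflectPerm_involutive]
  · rw [numCycles_inv]
    exact numCycles_reflectFace hab hbc hck

theorem reflectPairing_injective {a' b' c' : ℕ} (hab : a < b) (hbc : b < c) (hck : c ≤ k)
    (hab' : a' < b') (hbc' : b' < c') (hck' : c' ≤ k)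
    (h : ∀ x < 2 * k, reflectPairing k a b c x = reflectPairing k a' b' c' x) :
    a = a' ∧ b = b' ∧ c = c' := by
  -- The value at 0 is `a + c`. At `a + 1` it is `b + k`, whereas `a < a'` would make it `a' + c' -
  -- (a + 1) = c - 1 < k`.
  have h0 := h 0 (by omega)
  have h1 := h (a + 1) (by omega)
  have h2 := h (a' + 1) (by omega)
  have hs : a + c = a' + c' := by
    simpa [reflectPairing] using h0
  have ha : a = a' := by
    rcases lt_trichotomy a a' with hlt | heq | hlt
    · simp only [reflectPairing] at h1
      split_ifs at h1 <;> omega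
    · exact heq
    · simp only [reflectPairing] at h2
      split_ifs at h2 <;> omega
  subst ha
  simp only [reflectPairing] at h1
  refine ⟨rfl, ?_, by omega⟩
  split_ifs at h1 <;> omega

end ReflectPairing

/-! ### Counting the pairings -/

/-- The triples `a < b < c ≤ k`, listed as `⟨c, b, a⟩`. -/
def triples (k : ℕ) : Finset (Σ _ : ℕ, Σ _ : ℕ, ℕ) :=
  (range (k + 1)).sigma fun c => (range c).sigma fun b => range b

theorem mem_triples {k : ℕ} {t : Σ _ : ℕ, Σ _ : ℕ, ℕ} :
    t ∈ triples k ↔ t.2.2 < t.2.1 ∧ t.2.1 < t.1 ∧ t.1 ≤ k := by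
  simp only [triples, mem_sigma, mem_range, Nat.lt_succ_iff]
  tauto

theorem card_triples (k : ℕ) : #(triples k) = (k + 1).choose 3 := by
  have h2 : ∀ c : ℕ, ∑ b ∈ range c, b = c.choose 2 := by
    intro c
    induction c with
    | zero => rfl
    | succ c ih => rw [sum_range_succ, ih, Nat.choose_succ_succ c 1, Nat.choose_one_right, add_comm]
  simp only [triples, card_sigma, card_range, h2]
  generalize k + 1 = n
  induction n with
  | zero => rfl
  | succ n ih => rw [sum_range_succ, ih, Nat.choose_succ_succ n 2, add_comm]

theorem card_isGenusOnePairing (k : ℕ) :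
    Nat.card {ψ : Perm (Fin (2 * k)) // IsGenusOnePairing k ψ} = (k + 1).choose 3 := by
  classical
  rw [← card_triples, Nat.card_eq_fintype_card, Fintype.card_subtype]
  symm
  refine Finset.card_bij (fun t ht => (reflectFace (mem_triples.1 ht).1 (mem_triples.1 ht).2.1
    (mem_triples.1 ht).2.2)⁻¹) ?_ ?_ ?_
  · intro t ht
    rw [mem_filter]
    exact ⟨mem_univ _, (isGenusOnePairing_reflectFace_inv _ _ _).2⟩
  · rintro ⟨c, b, a⟩ ht ⟨c', b', a'⟩ ht' h
    obtain ⟨h1, h2, h3⟩ := mem_triples.1 ht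
    obtain ⟨h1', h2', h3'⟩ := mem_triples.1 ht'
    have heq : reflectPerm h1 h2 h3 = reflectPerm h1' h2' h3' := by
      rw [← (isGenusOnePairing_reflectFace_inv h1 h2 h3).1,
        ← (isGenusOnePairing_reflectFace_inv h1' h2' h3').1, h]
    obtain ⟨rfl, rfl, rfl⟩ := reflectPairing_injective h1 h2 h3 h1' h2' h3' fun x hx =>
      congrArg Fin.val (Equiv.congr_fun heq ⟨x, hx⟩)
    rfl
  · intro ψ hψ
    obtain ⟨a, b, c, hab, hbc, hck, h⟩ := (mem_filter.1 hψ).2.exists_eq_reflectPairing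
    refine ⟨⟨c, b, a⟩, mem_triples.2 ⟨hab, hbc, hck⟩, ?_⟩
    apply mul_left_cancel (a := finRotate (2 * k))
    rw [(isGenusOnePairing_reflectFace_inv hab hbc hck).1]
    exact Equiv.ext fun x => Fin.ext (h x).symm

/-! ### The generating function -/

section GeneratingFunction

/-- The power series `∑ f(i, j) xⁱ yʲ`. -/
noncomputable def seriesOf (f : ℕ → ℕ → ℚ) : MvPowerSeries (Fin 2) ℚ := fun m => f (m 0) (m 1)

theorem coeff_seriesOf (f : ℕ → ℕ → ℚ) (m : Fin 2 →₀ ℕ) :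
    MvPowerSeries.coeff m (seriesOf f) = f (m 0) (m 1) := rfl

theorem coeff_X_mul {σ R : Type*} [CommSemiring R] (s : σ) (m : σ →₀ ℕ)
    (φ : MvPowerSeries σ R) :
    MvPowerSeries.coeff m (X s * φ) =
      if m s = 0 then 0 else MvPowerSeries.coeff (m - Finsupp.single s 1) φ := by
  rw [X, MvPowerSeries.coeff_monomial_mul, one_mul]
  by_cases h : m s = 0
  · rw [if_pos h, if_neg]
    rw [Finsupp.single_le_iff]
    omega
  · rw [if_neg h, if_pos]
    rw [Finsupp.single_le_iff]
    omega

theorem X_zero_mul_seriesOf (f : ℕ → ℕ → ℚ) :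
    X 0 * seriesOf f = seriesOf fun i j => if i = 0 then 0 else f (i - 1) j := by
  ext m
  rw [coeff_X_mul, coeff_seriesOf, coeff_seriesOf]
  simp

theorem X_one_mul_seriesOf (f : ℕ → ℕ → ℚ) :
    X 1 * seriesOf f = seriesOf fun i j => if j = 0 then 0 else f i (j - 1) := by
  ext m
  rw [coeff_X_mul, coeff_seriesOf, coeff_seriesOf]
  simp

theorem C_eq_seriesOf (a : ℚ) :
    (MvPowerSeries.C a : MvPowerSeries (Fin 2) ℚ) =
      seriesOf fun i j => if i = 0 ∧ j = 0 then a else 0 := by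
  ext m
  rw [MvPowerSeries.coeff_C, coeff_seriesOf]
  have : m = 0 ↔ m 0 = 0 ∧ m 1 = 0 := by
    simp [Finsupp.ext_iff, Fin.forall_fin_two]
  simp only [this]

/-- The power series `∑ binom(n, 2 k) c(k) xⁿ yᵏ`. -/
noncomputable def chooseSeries (c : ℕ → ℚ) : MvPowerSeries (Fin 2) ℚ :=
  seriesOf fun i j => (i.choose (2 * j) : ℚ) * c j

/-- The second difference in `n` of `binom(n, 2 k + 2)` is `binom(n, 2 k)`. Thus multiplication by
the denominator turns the weights `c` into their differences, up to a boundary term. -/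
theorem mul_chooseSeries (c d : ℕ → ℚ) (hd : ∀ j, d j = c (j + 1) - c j) :
    ((1 - X 0) ^ 2 - X 1 * X 0 ^ 2) * chooseSeries c =
      (1 - X 0) * MvPowerSeries.C (c 0) + X 1 * X 0 ^ 2 * chooseSeries d := by
  have hl : ((1 - X 0) ^ 2 - X 1 * X 0 ^ 2) * chooseSeries c =
      chooseSeries c - X 0 * chooseSeries c - X 0 * chooseSeries c
        + X 0 * (X 0 * chooseSeries c) - X 1 * (X 0 * (X 0 * chooseSeries c)) := by ring
  have hr : (1 - X 0) * MvPowerSeries.C (c 0) + X 1 * X 0 ^ 2 * chooseSeries d =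
      MvPowerSeries.C (c 0) - X 0 * MvPowerSeries.C (c 0)
        + X 1 * (X 0 * (X 0 * chooseSeries d)) := by ring
  rw [hl, hr]
  simp only [chooseSeries, C_eq_seriesOf, X_zero_mul_seriesOf, X_one_mul_seriesOf]
  ext m
  simp only [map_add, map_sub, coeff_seriesOf]
  generalize m 0 = i
  generalize m 1 = j
  rcases i with _ | _ | i <;> rcases j with _ | j
  · simp
  · simp [mul_add]
  · simp
  · simp [mul_add, Nat.choose_eq_zero_of_lt]
  · simp
  · have h1 : (i + 1 + 1).choose (2 * j + 2) =
        i.choose (2 * j) + 2 * i.choose (2 * j + 1) + i.choose (2 * j + 2) := by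
      rw [Nat.choose_succ_succ, Nat.choose_succ_succ,
        Nat.choose_succ_succ]
      ring
    have h2 : (i + 1).choose (2 * j + 2) = i.choose (2 * j + 1) + i.choose (2 * j + 2) := by
      rw [Nat.choose_succ_succ]
    simp only [mul_add, mul_one, Nat.add_sub_cancel, h1, h2, hd, Nat.succ_ne_zero, if_false,
      false_and]
    push_cast
    ring

theorem R₀_eq_chooseSeries (h : ∀ n k, r₀ n k = n.choose (2 * k) * (k + 1).choose 3) :
    R₀ = chooseSeries fun k => ((k + 1).choose 3 : ℚ) := by
  ext m
  have : MvPowerSeries.coeff m R₀ = (r₀ (m 0) (m 1) : ℚ) := rfl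
  rw [this, h, chooseSeries, coeff_seriesOf, Nat.cast_mul]

/-- The weights run through `binom(k + 1, 3)`, `binom(k + 1, 2)`, `k + 1`, `1`, `0`, and only the
third and fourth have a nonzero boundary term. With `Q` the base of the power, these combine through
`Q + y x² = (1 - x)²`. -/
theorem chooseSeries_mul_eq :
    chooseSeries (fun k => ((k + 1).choose 3 : ℚ)) * ((1 - X 0) ^ 2 - X 1 * X 0 ^ 2) ^ 4 =
      X 1 ^ 2 * X 0 ^ 4 * (1 - X 0) ^ 3 := by
  have h3 := mul_chooseSeries (fun k => ((k + 1).choose 3 : ℚ)) (fun k => ((k + 1).choose 2 : ℚ))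
    fun j => by simp only [Nat.choose_succ_succ (j + 1) 2]; push_cast; ring
  have h2 := mul_chooseSeries (fun k => ((k + 1).choose 2 : ℚ)) (fun k => ((k : ℚ) + 1))
    fun j => by simp only [Nat.choose_succ_succ (j + 1) 1]; push_cast; simp
  have h1 := mul_chooseSeries (fun k => ((k : ℚ) + 1)) (fun _ => 1) fun j => by push_cast; ring
  have h0 := mul_chooseSeries (fun _ => 1) (fun _ => 0) fun j => by simp
  have hz : chooseSeries (fun _ => 0) = 0 := by
    ext m
    simp [chooseSeries, coeff_seriesOf]
  simp only [hz, mul_zero, add_zero, zero_add, Nat.cast_zero, map_one,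
    mul_one, show Nat.choose 1 3 = 0 from rfl, show Nat.choose 1 2 = 0 from rfl, map_zero]
    at h0 h1 h2 h3
  generalize chooseSeries (fun k => ((k + 1).choose 3 : ℚ)) = A₃ at *
  generalize chooseSeries (fun k => ((k + 1).choose 2 : ℚ)) = A₂ at *
  generalize chooseSeries (fun k => ((k : ℚ) + 1)) = A₁ at *
  generalize chooseSeries (fun _ => 1) = A₀ at *
  generalize hQ : ((1 - X 0) ^ 2 - X 1 * X 0 ^ 2 : MvPowerSeries (Fin 2) ℚ) = Q at *
  calc A₃ * Q ^ 4 = Q ^ 3 * (Q * A₃) := by ring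
    _ = X 1 * X 0 ^ 2 * Q ^ 2 * (Q * A₂) := by rw [h3]; ring
    _ = X 1 ^ 2 * X 0 ^ 4 * Q * (Q * A₁) := by rw [h2]; ring
    _ = X 1 ^ 2 * X 0 ^ 4 * (Q * (1 - X 0) + X 1 * X 0 ^ 2 * (Q * A₀)) := by rw [h1]; ring
    _ = X 1 ^ 2 * X 0 ^ 4 * (1 - X 0) ^ 3 := by rw [h0, ← hQ]; ring

theorem constantCoeff_denominator :
    MvPowerSeries.constantCoeff
      (((1 - X 0) ^ 2 - X 1 * X 0 ^ 2) ^ 4 : MvPowerSeries (Fin 2) ℚ) = 1 := by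
  simp

end GeneratingFunction

end GenusPartition

theorem theorem3p1 :
    (∀ n k : ℕ, GenusPartition.r₀ n k = n.choose (2 * k) * (k + 1).choose 3) ∧
    IsUnit (((1 - X 0) ^ 2 - X 1 * X 0 ^ 2) ^ 4 : MvPowerSeries (Fin 2) ℚ) ∧
    GenusPartition.R₀ =
      X 1 ^ 2 * X 0 ^ 4 * (1 - X 0) ^ 3 * (((1 - X 0) ^ 2 - X 1 * X 0 ^ 2) ^ 4)⁻¹ := by
  have h : ∀ n k : ℕ, GenusPartition.r₀ n k = n.choose (2 * k) * (k + 1).choose 3 := fun n k => by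
    rw [GenusPartition.r₀_eq_choose_mul, GenusPartition.card_isGenusOnePairing]
  refine ⟨h, ?_, ?_⟩
  · rw [MvPowerSeries.isUnit_iff_constantCoeff, GenusPartition.constantCoeff_denominator]
    exact isUnit_one
  · rw [MvPowerSeries.eq_mul_inv_iff_mul_eq
      (by rw [GenusPartition.constantCoeff_denominator]; exact one_ne_zero),
      GenusPartition.R₀_eq_chooseSeries h]
    exact GenusPartition.chooseSeries_mul_eq
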